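/- **Proposition (consistency for smooth varifolds).** Let $d\ge 1$ and $n=d+1$. Let $\rho,\xi\in C^\infty(\mathbb R)$ be nonnegative, even, supported in $[-1,1]$, positive on $(0,1)$, with $\rho$ nonincreasing on $[0,1]$ and $n\,\xi(s)=-s\,\rho'(s)$ for all $s\in(-1,1)$. Let $M\subset\mathbb R^n$ be an embedded $d$-dimensional submanifold (hypersurface, without boundary, not necessarily closed) of class $C^2$, with tangent spaces $T_xM$ and mean curvature vector $H(x)\in\mathbb R^n$, the trace over $T_xM$ of the (normal-vector-valued) second fundamental form. Let $G_{d,n}$ be the Grassmannian of $d$-dimensional subspaces of $\mathbb R^n$, and let $V=\mathcal H^d_{|M}\otimes\delta_{T_xM}$, i.e. the measure on $\mathbb R^n\times G_{d,n}$ with $V(B)=\mathcal H^d(\{x\in M:(x,T_xM)\in B\})$ for Borel $B$. Let $\|V\|$ be its mass, $\|V\|(A)=V(A\times G_{d,n})$. For a subspace $S$ let $\Pi_S$ be the orthogonal projector onto $S$. For $x_0\in\mathbb R^n$, $\varepsilon>0$, and a linear operator $\Pi=\Pi(x_0,x,S)$ on $\mathbb R^n$, set $$H_\varepsilon^{\Pi}(x_0,V)=-\frac{d}{n\,\varepsilon}\;\frac{\displaystyle\int_{\mathbb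 R^n\times G_{d,n}}\rho'\!\left(\frac{|x-x_0|}{\varepsilon}\right)\frac{\Pi(x-x_0)}{|x-x_0|}\,dV(x,S)}{\displaystyle\int_{\mathbb R^n}\xi\!\left(\frac{|x-x_0|}{\varepsilon}\right)d\|V\|(x)}$$ (the first integrand being $0$ at $x=x_0$). Then for every $x_0\in M$ and every $$\Pi\in\left\{\Pi_S,\;-2\,\Pi_{S^\perp},\;2\,\mathrm{Id},\;\Pi_{(T_{x_0}M)^\perp}\circ\Pi_S,\;-2\,\Pi_{(T_{x_0}M)^\perp}\circ\Pi_{S^\perp},\;2\,\Pi_{(T_{x_0}M)^\perp}\right\},$$ for all sufficiently small $\varepsilon>0$ both integrals converge absolutely and the denominator is positive, and $$H_\varepsilon^{\Pi}(x_0,V)\longrightarrow H(x_0)\qquad\text{as }\varepsilon\to0^+.$$ If moreover $M$ is of class $C^3$, then $\left|H_\varepsilon^{\Pi}(x_0,V)-H(x_0)\right|=O(\varepsilon)$ as $\varepsilon\to0^+$, for each such $x_0$ and $\Pi$. -/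

import Mathlib

open Set Filter Topology MeasureTheory
open scoped ContDiff

noncomputable section

namespace Varifold

/-! ### Hypersurfaces, tangent spaces and mean curvature -/

/-- `M ⊆ ℝ^{d+1}` is an (embedded, boundaryless) `d`-submanifold of class `C^k`: near each of its
points it is the zero set of a `C^k` function whose differential does not vanish. -/
def IsHypersurface (d : ℕ) (k : ℕ) (M : Set (EuclideanSpace ℝ (Fin (d + 1)))) : Prop :=
  ∀ x ∈ M, ∃ (U : Set (EuclideanSpace ℝ (Fin (d + 1)))) (f : EuclideanSpace ℝ (Fin (d + 1)) → ℝ),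
    IsOpen U ∧ x ∈ U ∧ ContDiffOn ℝ k f U ∧ (∀ y ∈ U, fderiv ℝ f y ≠ 0) ∧
      M ∩ U = {y ∈ U | f y = 0}

theorem IsHypersurface.of_le {d k l : ℕ} {M : Set (EuclideanSpace ℝ (Fin (d + 1)))}
    (hM : IsHypersurface d k M) (h : l ≤ k) : IsHypersurface d l M := by
  intro x hx
  obtain ⟨U, f, hU, hxU, hf, hf', hMU⟩ := hM x hx
  exact ⟨U, f, hU, hxU, hf.of_le (by exact_mod_cast h), hf', hMU⟩

/-- The tangent space `T_x M`, spanned by all limits of secant directions of `M` at `x`. -/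
def tangentSpace {n : ℕ} (M : Set (EuclideanSpace ℝ (Fin n))) (x : EuclideanSpace ℝ (Fin n)) :
    Submodule ℝ (EuclideanSpace ℝ (Fin n)) :=
  Submodule.span ℝ (tangentConeAt ℝ M x)

/-- The second fundamental form `II_x(v, w) = (D_v W)^⊥` of `M` at `x`, where `W` is the tangential
vector field `W(y) = Π_{T_y M} w` extending the tangent vector `w`. The derivative is taken along
`M`, so that it is determined on tangent vectors `v` by the values of `W` on `M`. -/
def secondFundamentalForm {n : ℕ} (M : Set (EuclideanSpace ℝ (Fin n)))
    (x v w : EuclideanSpace ℝ (Fin n)) : EuclideanSpace ℝ (Fin n) :=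
  (tangentSpace M x)ᗮ.starProjection
    (fderivWithin ℝ (fun y => (tangentSpace M y).starProjection w) M x v)

/-- The classical mean curvature vector `H(x)`: the trace of the second fundamental form over an
orthonormal basis of `T_x M` (the sum of the principal curvatures, not their average). -/
def meanCurvatureVector {n : ℕ} (M : Set (EuclideanSpace ℝ (Fin n)))
    (x : EuclideanSpace ℝ (Fin n)) : EuclideanSpace ℝ (Fin n) :=
  ∑ i, secondFundamentalForm M x
    (stdOrthonormalBasis ℝ (tangentSpace M x) i : EuclideanSpace ℝ (Fin n))
    (stdOrthonormalBasis ℝ (tangentSpace M x) i : EuclideanSpace ℝ (Fin n))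

/-! ### The Grassmannian -/

/-- The Grassmannian `G_{d,n}` of `d`-dimensional linear subspaces of `ℝ^n`. -/
def Grassmannian (d n : ℕ) : Type :=
  {S : Submodule ℝ (EuclideanSpace ℝ (Fin n)) // Module.finrank ℝ S = d}

/-- The orthogonal projector `Π_S` onto a `d`-plane. -/
def Grassmannian.proj {d n : ℕ} (S : Grassmannian d n) :
    EuclideanSpace ℝ (Fin n) →L[ℝ] EuclideanSpace ℝ (Fin n) :=
  S.1.starProjection

/-- The orthogonal projector `Π_{S^⊥}` onto the orthogonal complement of a `d`-plane. -/
def Grassmannian.projPerp {d n : ℕ} (S : Grassmannian d n) :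
    EuclideanSpace ℝ (Fin n) →L[ℝ] EuclideanSpace ℝ (Fin n) :=
  S.1ᗮ.starProjection

theorem Grassmannian.proj_injective (d n : ℕ) :
    Function.Injective (Grassmannian.proj : Grassmannian d n → _) := by
  intro S T h
  exact Subtype.ext (Submodule.starProjection_inj.1 h)

/-- The distance on the Grassmannian: operator norm of the difference of the projectors. -/
instance (d n : ℕ) : MetricSpace (Grassmannian d n) :=
  MetricSpace.induced Grassmannian.proj (Grassmannian.proj_injective d n) inferInstance

instance (d n : ℕ) : MeasurableSpace (Grassmannian d n) := borel _

instance (d n : ℕ) : BorelSpace (Grassmannian d n) := ⟨rfl⟩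

/-! ### Regularized mean curvature of a varifold -/

/-- The mass `‖V‖` of a varifold: `‖V‖(A) = V(A × G_{d,n})`. -/
def mass {d n : ℕ} (V : Measure (EuclideanSpace ℝ (Fin n) × Grassmannian d n)) :
    Measure (EuclideanSpace ℝ (Fin n)) :=
  V.map Prod.fst

/-- The admissible pairs of kernel profiles `(ρ, ξ)` in `ℝ^n`. -/
structure IsKernelPair (n : ℕ) (ρ ξ : ℝ → ℝ) : Prop where
  smooth_rho : ContDiff ℝ ∞ ρ
  smooth_xi : ContDiff ℝ ∞ ξ
  nonneg_rho : ∀ s, 0 ≤ ρ s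
  nonneg_xi : ∀ s, 0 ≤ ξ s
  even_rho : ∀ s, ρ (-s) = ρ s
  even_xi : ∀ s, ξ (-s) = ξ s
  support_rho : tsupport ρ ⊆ Icc (-1) 1
  support_xi : tsupport ξ ⊆ Icc (-1) 1
  pos_rho : ∀ s ∈ Ioo (0 : ℝ) 1, 0 < ρ s
  pos_xi : ∀ s ∈ Ioo (0 : ℝ) 1, 0 < ξ s
  anti_rho : AntitoneOn ρ (Icc 0 1)
  relation : ∀ s ∈ Ioo (-1 : ℝ) 1, n * ξ s = -(s * deriv ρ s)

/-- The integrand `ρ'(|x - x₀| / ε) Π(x - x₀) / |x - x₀|` of the regularized first variation,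
equal to `0` at `x = x₀`. The operator `Π` may depend on `x` and `S`. -/
def variationIntegrand {d n : ℕ} (ρ : ℝ → ℝ)
    (P : EuclideanSpace ℝ (Fin n) × Grassmannian d n →
      (EuclideanSpace ℝ (Fin n) →L[ℝ] EuclideanSpace ℝ (Fin n)))
    (ε : ℝ) (x₀ : EuclideanSpace ℝ (Fin n)) (p : EuclideanSpace ℝ (Fin n) × Grassmannian d n) :
    EuclideanSpace ℝ (Fin n) :=
  (deriv ρ (‖p.1 - x₀‖ / ε) / ‖p.1 - x₀‖) • P p (p.1 - x₀)

/-- The integrand `ξ(|x - x₀| / ε)` of the regularized mass. -/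
def massIntegrand {n : ℕ} (ξ : ℝ → ℝ) (ε : ℝ) (x₀ x : EuclideanSpace ℝ (Fin n)) : ℝ :=
  ξ (‖x - x₀‖ / ε)

/-- The regularized mean curvature `H_ε^Π(x₀, V)` of a `d`-varifold `V` in `ℝ^n`. -/
def regMeanCurvature {d n : ℕ} (ρ ξ : ℝ → ℝ)
    (P : EuclideanSpace ℝ (Fin n) × Grassmannian d n →
      (EuclideanSpace ℝ (Fin n) →L[ℝ] EuclideanSpace ℝ (Fin n)))
    (ε : ℝ) (x₀ : EuclideanSpace ℝ (Fin n))
    (V : Measure (EuclideanSpace ℝ (Fin n) × Grassmannian d n)) : EuclideanSpace ℝ (Fin n) :=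
  (-((d : ℝ) / (n * ε)) / ∫ x, massIntegrand ξ ε x₀ x ∂(mass V)) •
    ∫ p, variationIntegrand ρ P ε x₀ p ∂V

/-- The six choices of `Π`, as functions of `(x, S)`; `N` is the normal space
`(T_{x₀} M)^⊥` at the base point. -/
def projectionChoices {n : ℕ} (d : ℕ) (N : Submodule ℝ (EuclideanSpace ℝ (Fin n))) :
    Set (EuclideanSpace ℝ (Fin n) × Grassmannian d n →
      (EuclideanSpace ℝ (Fin n) →L[ℝ] EuclideanSpace ℝ (Fin n))) :=
  {fun p => p.2.proj,
   fun p => (-2 : ℝ) • p.2.projPerp,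
   fun _ => (2 : ℝ) • ContinuousLinearMap.id ℝ (EuclideanSpace ℝ (Fin n)),
   fun p => N.starProjection ∘L p.2.proj,
   fun p => (-2 : ℝ) • (N.starProjection ∘L p.2.projPerp),
   fun _ => (2 : ℝ) • N.starProjection}

/-! ### The varifold of a hypersurface -/

theorem tangentSpace_eq_ker {n : ℕ} {M U : Set (EuclideanSpace ℝ (Fin n))}
    {f : EuclideanSpace ℝ (Fin n) → ℝ} {x : EuclideanSpace ℝ (Fin n)} (hx : x ∈ M)
    (hU : IsOpen U) (hxU : x ∈ U) (hf : ContDiffOn ℝ 1 f U) (hf' : fderiv ℝ f x ≠ 0)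
    (hMU : M ∩ U = {y ∈ U | f y = 0}) :
    tangentSpace M x = (fderiv ℝ f x).ker := by
  have hUx : U ∈ 𝓝 x := hU.mem_nhds hxU
  have hmem : ∀ y ∈ U, (y ∈ M ↔ f y = 0) := by
    intro y hy
    have := Set.ext_iff.1 hMU y
    simp only [mem_inter_iff, hy, and_true] at this
    simpa [hy] using this
  have hfx : f x = 0 := (hmem x hxU).1 hx
  have hs : HasStrictFDerivAt f (fderiv ℝ f x) x :=
    (hf.contDiffAt hUx).hasStrictFDerivAt one_ne_zero
  apply le_antisymm
  · rw [tangentSpace, Submodule.span_le]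
    intro v hv
    have h1 : HasFDerivWithinAt f (fderiv ℝ f x) M x := hs.hasFDerivAt.hasFDerivWithinAt
    have h2 : HasFDerivWithinAt f (0 : EuclideanSpace ℝ (Fin n) →L[ℝ] ℝ) M x := by
      refine (hasFDerivWithinAt_const (0 : ℝ) x M).congr_of_eventuallyEq ?_ hfx
      filter_upwards [self_mem_nhdsWithin, mem_nhdsWithin_of_mem_nhds hUx] with y hy hyU
      exact (hmem y hyU).1 hy
    simpa using h1.unique_on h2 hv
  · intro v hv
    have hsurj : (fderiv ℝ f x).range = ⊤ := by
      rw [LinearMap.range_eq_top]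
      exact LinearMap.surjective fun h => hf' (ContinuousLinearMap.coe_injective h)
    have hg := hs.to_implicitFunction hsurj
    have hz := hs.map_implicitFunction_eq hsurj
    set g := hs.implicitFunction f (fderiv ℝ f x) hsurj (f x) with hgdef
    have hg0 : g 0 = x := by
      exact hs.implicitFunction_apply_image hsurj
    let w : (fderiv ℝ f x).ker := ⟨v, hv⟩
    have hc : HasDerivAt (fun t : ℝ => g (t • w)) v 0 := by
      have h1 : HasDerivAt (fun t : ℝ => t • w) w 0 := by
        simpa using (hasDerivAt_id (0 : ℝ)).smul_const w
      have h2 : HasFDerivAt g (fderiv ℝ f x).ker.subtypeL ((0 : ℝ) • w) := by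
        simpa using hg.hasFDerivAt
      exact h2.comp_hasDerivAt (0 : ℝ) h1
    have hzt : ∀ᶠ t : ℝ in 𝓝 0, f (g (t • w)) = 0 := by
      have ht : Tendsto (fun t : ℝ => (f x, t • w)) (𝓝 0) (𝓝 (f x, 0)) := by
        have : Continuous (fun t : ℝ => (f x, t • w)) := by fun_prop
        simpa using this.tendsto (0 : ℝ)
      filter_upwards [ht.eventually hz] with t ht
      rw [← hfx]; exact ht
    have hUt : ∀ᶠ t : ℝ in 𝓝 0, g (t • w) ∈ U := by
      have := hc.continuousAt.tendsto
      simp only [zero_smul, hg0] at this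
      exact this.eventually hUx
    apply Submodule.subset_span
    refine mem_tangentConeAt_of_seq (𝓝[≠] (0 : ℝ)) (fun t => t⁻¹) (fun t => g (t • w) - x) ?_ ?_ ?_
    · have := hc.continuousAt.tendsto
      simp only [zero_smul, hg0] at this
      have h3 := this.sub_const x
      rw [sub_self] at h3
      exact h3.mono_left nhdsWithin_le_nhds
    · refine Filter.Eventually.filter_mono nhdsWithin_le_nhds ?_
      filter_upwards [hzt, hUt] with t h1 h2
      simpa using (hmem _ h2).2 h1
    · have := hasDerivAt_iff_tendsto_slope.1 hc
      refine this.congr fun t => ?_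
      simp [slope_def_module, hg0]

theorem ker_eq_orthogonal {n : ℕ} (L : EuclideanSpace ℝ (Fin n) →L[ℝ] ℝ) :
    L.ker = (ℝ ∙ ((InnerProductSpace.toDual ℝ _).symm L))ᗮ := by
  ext v
  rw [Submodule.mem_orthogonal_singleton_iff_inner_right]
  simp

theorem IsHypersurface.finrank_tangentSpace {d : ℕ} {M : Set (EuclideanSpace ℝ (Fin (d + 1)))}
    (hM : IsHypersurface d 1 M) {x : EuclideanSpace ℝ (Fin (d + 1))} (hx : x ∈ M) :
    Module.finrank ℝ (tangentSpace M x) = d := by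
  obtain ⟨U, f, hU, hxU, hf, hf', hMU⟩ := hM x hx
  rw [tangentSpace_eq_ker hx hU hxU (by simpa using hf) (hf' x hxU) hMU, ker_eq_orthogonal]
  have : Fact (Module.finrank ℝ (EuclideanSpace ℝ (Fin (d + 1))) = d + 1) := ⟨by simp⟩
  exact Submodule.finrank_orthogonal_span_singleton (by simpa using hf' x hxU)

/-- The tangent plane `T_x M` as an element of the Grassmannian. -/
def tangentPlane {d : ℕ} {M : Set (EuclideanSpace ℝ (Fin (d + 1)))} (hM : IsHypersurface d 1 M)
    (x : M) : Grassmannian d (d + 1) :=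
  ⟨tangentSpace M x.1, hM.finrank_tangentSpace x.2⟩

/-- The smooth varifold `V = H^d|_M ⊗ δ_{T_x M}`: the image of the `d`-dimensional Hausdorff
measure on `M` under `x ↦ (x, T_x M)`. -/
def smoothVarifold {d : ℕ} (M : Set (EuclideanSpace ℝ (Fin (d + 1)))) (hM : IsHypersurface d 1 M) :
    Measure (EuclideanSpace ℝ (Fin (d + 1)) × Grassmannian d (d + 1)) :=
  Measure.map (fun x : M => (x.1, tangentPlane hM x))
    (Measure.comap Subtype.val (Measure.euclideanHausdorffMeasure d))

theorem IsHypersurface.measurableSet {d : ℕ} {M : Set (EuclideanSpace ℝ (Fin (d + 1)))}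
    (hM : IsHypersurface d 1 M) : MeasurableSet M := by
  have h : IsLocallyClosed M := by
    refine ((isLocallyClosed_tfae M).out 0 3).2 ?_
    intro x hx
    obtain ⟨U, f, hU, hxU, hf, hf', hMU⟩ := hM x hx
    refine ⟨U, hxU, hU, ?_⟩
    rintro y ⟨hyU, hy⟩
    have hcont : ContinuousAt f y := hf.continuousOn.continuousAt (hU.mem_nhds hyU)
    have : f y = 0 := by
      have hfr : ∃ᶠ z in 𝓝 y, f z = 0 := by
        refine ((mem_closure_iff_frequently.1 hy).and_eventually (hU.mem_nhds hyU)).mono ?_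
        rintro z ⟨hz, hzU⟩
        have : z ∈ M ∩ U := ⟨hz, hzU⟩
        rw [hMU] at this
        exact this.2
      by_contra hne
      exact hfr (hcont.eventually_ne hne)
    have hyM : y ∈ M ∩ U := by rw [hMU]; exact ⟨hyU, this⟩
    exact hyM.1
  obtain ⟨U, Z, hU, hZ, rfl⟩ := h
  exact hU.measurableSet.inter hZ.measurableSet

theorem continuous_tangentPlane {d : ℕ} {M : Set (EuclideanSpace ℝ (Fin (d + 1)))}
    (hM : IsHypersurface d 1 M) : Continuous (tangentPlane hM) := by
  have hind : IsInducing (Grassmannian.proj : Grassmannian d (d + 1) → _) := ⟨rfl⟩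
  rw [hind.continuous_iff, continuous_iff_continuousAt]
  rintro ⟨x, hx⟩
  obtain ⟨U, f, hU, hxU, hf, hf', hMU⟩ := hM x hx
  set ν : EuclideanSpace ℝ (Fin (d + 1)) → EuclideanSpace ℝ (Fin (d + 1)) :=
    fun y => (InnerProductSpace.toDual ℝ _).symm (fderiv ℝ f y) with hν
  have hνc : ContinuousAt ν x := by
    have := (hf.continuousOn_fderiv_of_isOpen hU (by simp)).continuousAt (hU.mem_nhds hxU)
    exact (InnerProductSpace.toDual ℝ _).symm.continuous.continuousAt.comp this
  have hνx : ν x ≠ 0 := by simpa [hν] using hf' x hxU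
  have key : ContinuousAt (fun y => ContinuousLinearMap.id ℝ _ -
      ((‖ν y‖ ^ 2)⁻¹) • (innerSL ℝ (ν y)).smulRight (ν y)) x := by
    have hne : ‖ν x‖ ^ 2 ≠ 0 := by simpa using hνx
    refine continuousAt_const.sub (((hνc.norm.pow 2).inv₀ hne).smul ?_)
    have : Continuous (fun v : EuclideanSpace ℝ (Fin (d + 1)) => (innerSL ℝ v).smulRight v) := by
      fun_prop
    exact this.continuousAt.comp hνc
  have key' := key.comp (f := (Subtype.val : M → _)) (x := ⟨x, hx⟩)
    continuous_subtype_val.continuousAt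
  refine key'.congr ?_
  have hUm : (Subtype.val : M → _) ⁻¹' U ∈ 𝓝 (⟨x, hx⟩ : M) :=
    continuous_subtype_val.continuousAt.preimage_mem_nhds (hU.mem_nhds hxU)
  filter_upwards [hUm] with y hy
  ext1 v
  have e : tangentSpace M y.1 = (ℝ ∙ ν y.1)ᗮ := by
    rw [tangentSpace_eq_ker y.2 hU hy (by simpa using hf) (hf' _ hy) hMU, ker_eq_orthogonal]
  simp only [Function.comp, Grassmannian.proj, tangentPlane, e,
    Submodule.starProjection_orthogonal, Submodule.starProjection_singleton,
    sub_apply, smul_apply,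
    ContinuousLinearMap.smulRight_apply, innerSL_apply_apply, smul_smul]
  simp [div_eq_inv_mul]

/-- The defining formula `V(B) = H^d {x ∈ M | (x, T_x M) ∈ B}` of the smooth varifold. -/
theorem smoothVarifold_apply {d : ℕ} {M : Set (EuclideanSpace ℝ (Fin (d + 1)))}
    (hM : IsHypersurface d 1 M)
    {B : Set (EuclideanSpace ℝ (Fin (d + 1)) × Grassmannian d (d + 1))} (hB : MeasurableSet B) :
    smoothVarifold M hM B =
      Measure.euclideanHausdorffMeasure d {x | ∃ hx : x ∈ M, (x, tangentPlane hM ⟨x, hx⟩) ∈ B} := by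
  have hm : Measurable (fun x : M => (x.1, tangentPlane hM x)) :=
    measurable_subtype_coe.prodMk (continuous_tangentPlane hM).measurable
  rw [smoothVarifold, Measure.map_apply hm hB,
    (MeasurableEmbedding.subtype_coe hM.measurableSet).comap_apply]
  congr 1
  ext x
  simp

end Varifold

end

open Varifold

/-!
The integrals over `M` near `x₀` are compared with integrals over the tangent plane `T = ν^⊥` at
`x₀`. Write `z = x - x₀`, let `y` be the projection of `z` to `T`, and normalise a local equation
`f = 0` of `M` so that `Df(x₀) = ⟨ν, ·⟩`; put `b = D²f(x₀)`. Taylor expansion of `f` and `Df` on `M`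
gives `⟨ν, z⟩ = -½ b(y, y) + o(|y|²)` and `⟨z, ∇f(x)⟩ = ½ b(y, y) + o(|y|²)`. Hence, for each of the
six choices, `Π(z) = l y - b(y, y) ν + o(|y|²)` with a constant `l`
(`exists_norm_projectionChoice_sub_le`): the choices differ only in the linear term. The quadratic
term is the second fundamental form, so its trace is `H(x₀)`
(`IsNormalChart.meanCurvatureVector_eq`).

No area formula is needed to transfer the integrals. The projection `M → T` is `1`-Lipschitz, and
near `x₀` its inverse is Lipschitz with constant `1 + O(ε²)`, because `M` is tangent to `T` at `x₀`;
so it pushes the Hausdorff measure of `M` in the `ε`-ball to a measure squeezed between Lebesgue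
measure and `1 + O(ε²)` times it (`volume_restrict_le_map_and_map_le`,
`IsNormalChart.integrable_and_norm_integral_sub_le`). This accuracy matters: the numerator is of
order `ε ^ (d + 1)` while its integrand is only bounded, so it would not suffice to know the measure
up to a factor `1 + O(ε)`.

On `T` the linear term integrates to zero by symmetry and the quadratic one to its trace times
`(1 / d) ∫ ρ'(|y| / ε) |y| dy`, by rotation invariance (`integral_radial_smul_quadratic`). The
relation `n ξ(s) = -s ρ'(s)` turns this into `-(n ε / d) ∫ ξ(|y| / ε) dy`, which the normalisation
of the regularised mean curvature cancels exactly. All errors are at most a multiple of `ε + η`,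
where `η` is the relative accuracy of the affine approximation of `Df` at scale `2ε`
(`IsNormalChart.exists_estimate`): `η → 0` for `C²` hypersurfaces, and `η = O(ε)` for `C³` ones.
-/

/-! ### Comparison of the measure on a hypersurface with Lebesgue measure -/

/-- A `1`-Lipschitz map with a `K`-Lipschitz inverse from `D` to `S` pushes the `d`-dimensional
Hausdorff measure on `S` to a measure between Lebesgue measure on `D` and `K ^ d` times it. -/
theorem volume_restrict_le_map_and_map_le
    {X T : Type*} [MetricSpace X] [MeasurableSpace X] [BorelSpace X]
    [NormedAddCommGroup T] [InnerProductSpace ℝ T] [FiniteDimensional ℝ T] [MeasurableSpace T]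
    [BorelSpace T] {d : ℕ} (hd : Module.finrank ℝ T = d) {p : X → T} (hp : LipschitzWith 1 p)
    {S : Set X} {D : Set T} (hD : p '' S = D)
    {K : NNReal} (hK : ∀ x ∈ S, ∀ y ∈ S, dist x y ≤ K * dist (p x) (p y)) :
    volume.restrict D ≤ ((μHE[d] : Measure X).restrict S).map p ∧
      ((μHE[d] : Measure X).restrict S).map p ≤ ((K : ENNReal) ^ d) • volume.restrict D := by
  have hpm : Measurable p := hp.continuous.measurable
  have hvol : (volume : Measure T) = μHE[d] := by
    rw [← hd, InnerProductSpace.euclideanHausdorffMeasure_eq_volume]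
  constructor
  · refine Measure.le_iff.2 fun A hA => ?_
    rw [Measure.restrict_apply hA, Measure.map_apply hpm hA, Measure.restrict_apply (hpm hA), hvol]
    have : A ∩ D = p '' (p ⁻¹' A ∩ S) := by rw [← hD, image_preimage_inter]
    rw [this]
    simp only [Measure.euclideanHausdorffMeasure_def, Measure.smul_apply]
    gcongr
    simpa using hp.hausdorffMeasure_image_le (d := d) (by positivity) (p ⁻¹' A ∩ S)
  · refine Measure.le_iff.2 fun A hA => ?_
    rw [Measure.smul_apply, Measure.restrict_apply hA, Measure.map_apply hpm hA,
      Measure.restrict_apply (hpm hA), hvol]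
    have ha : AntilipschitzWith K (fun x : S => p x) :=
      AntilipschitzWith.of_le_mul_dist fun x y => hK x x.2 y y.2
    have h1 : p ⁻¹' A ∩ S = Subtype.val '' ((fun x : S => p x) ⁻¹' (A ∩ D)) := by
      ext x
      simp only [mem_inter_iff, mem_preimage, mem_image, Subtype.exists, exists_and_right,
        exists_eq_right, ← hD]
      constructor
      · rintro ⟨h1, h2⟩; exact ⟨⟨h2, h1⟩, x, h2, rfl⟩
      · rintro ⟨⟨h2, h1⟩, -⟩; exact ⟨h1, h2⟩
    rw [h1, isometry_subtype_coe.euclideanHausdorffMeasure_image]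
    simp only [Measure.euclideanHausdorffMeasure_def, Measure.smul_apply]
    rw [smul_comm]
    gcongr
    simpa using ha.hausdorffMeasure_preimage_le (d := d) (by positivity) (A ∩ D)

/-- If `μ ≤ ν ≤ (1 + κ) μ`, then `ν - μ` has mass at most `κ μ(univ)`, which bounds the difference
of the integrals of a bounded function. -/
theorem norm_integral_sub_integral_le_of_le {T G : Type*} [MeasurableSpace T]
    [NormedAddCommGroup G] [NormedSpace ℝ G] {μ ν : Measure T} [IsFiniteMeasure μ] {κ K : ℝ}
    (hκ : 0 ≤ κ) (h₁ : μ ≤ ν) (h₂ : ν ≤ ENNReal.ofReal (1 + κ) • μ) {F : T → G}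
    (hF : StronglyMeasurable F) (hK : ∀ y, ‖F y‖ ≤ K) :
    ‖∫ y, F y ∂ν - ∫ y, F y ∂μ‖ ≤ K * (κ * μ.real univ) := by
  have hfin : IsFiniteMeasure (ENNReal.ofReal (1 + κ) • μ) :=
    ⟨by simpa using ENNReal.mul_lt_top ENNReal.ofReal_lt_top (measure_lt_top μ univ)⟩
  have hν : IsFiniteMeasure ν := isFiniteMeasure_of_le _ h₂
  have hint : ∀ (τ : Measure T) [IsFiniteMeasure τ], Integrable F τ := fun τ _ =>
    Integrable.of_bound hF.aestronglyMeasurable K (Eventually.of_forall hK)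
  have hsum : ν - μ + μ = ν := Measure.sub_add_cancel_of_le h₁
  have e : ∫ y, F y ∂ν = ∫ y, F y ∂(ν - μ) + ∫ y, F y ∂μ := by
    conv_lhs => rw [← hsum]
    exact integral_add_measure (hint _) (hint _)
  rw [e, add_sub_cancel_right]
  have hmass : (ν - μ).real univ ≤ κ * μ.real univ := by
    have h3 : (ν - μ).real univ + μ.real univ = ν.real univ := by
      rw [← measureReal_add_apply, hsum]
    have h4 : ν.real univ ≤ (1 + κ) * μ.real univ := by
      have := ENNReal.toReal_mono (measure_ne_top _ univ) (h₂ univ)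
      simpa [measureReal_def, ENNReal.toReal_ofReal (by linarith : 0 ≤ 1 + κ)] using this
    linarith
  rcases isEmpty_or_nonempty T with hT | ⟨⟨y₀⟩⟩
  · simp [Measure.eq_zero_of_isEmpty, integral_zero_measure]
  have hK0 : 0 ≤ K := (norm_nonneg _).trans (hK y₀)
  calc _ ≤ K * (ν - μ).real univ := norm_integral_le_of_norm_le_const (Eventually.of_forall hK)
    _ ≤ _ := by gcongr

/-- The integral over `X` of a function `F` that vanishes off `S` and is `δ`-close on `S` to a model
`F₀ ∘ p`, compared with the integral of `F₀` over `T`, when the image of `m|_S` under `p` is squeezed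
between `μ` and `(1 + κ) μ`. -/
theorem integrable_and_norm_integral_sub_le {X T G : Type*} [MeasurableSpace X] [MeasurableSpace T]
    [NormedAddCommGroup G] [NormedSpace ℝ G] {m : Measure X} {μ : Measure T}
    [IsFiniteMeasure μ] {p : X → T} (hp : Measurable p) {S : Set X} (hS : MeasurableSet S)
    {κ K δ : ℝ} (hκ : 0 ≤ κ) (hδ : 0 ≤ δ)
    (h₁ : μ ≤ (m.restrict S).map p) (h₂ : (m.restrict S).map p ≤ ENNReal.ofReal (1 + κ) • μ)
    {F : X → G} (hF : StronglyMeasurable F) (hF0 : ∀ x ∉ S, F x = 0)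
    {F₀ : T → G} (hF₀ : StronglyMeasurable F₀) (hK : ∀ y, ‖F₀ y‖ ≤ K)
    (hFF₀ : ∀ x ∈ S, ‖F x - F₀ (p x)‖ ≤ δ) :
    Integrable F m ∧
      ‖∫ x, F x ∂m - ∫ y, F₀ y ∂μ‖ ≤ (δ * (1 + κ) + K * κ) * μ.real univ := by
  have hfin : IsFiniteMeasure (ENNReal.ofReal (1 + κ) • μ) :=
    ⟨by simpa using ENNReal.mul_lt_top ENNReal.ofReal_lt_top (measure_lt_top μ univ)⟩
  have hν : IsFiniteMeasure ((m.restrict S).map p) := isFiniteMeasure_of_le _ h₂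
  have hu : ((m.restrict S).map p) univ = m.restrict S univ := by
    rw [Measure.map_apply hp MeasurableSet.univ, preimage_univ]
  have hmS : IsFiniteMeasure (m.restrict S) := ⟨by rw [← hu]; exact measure_lt_top _ _⟩
  have hmass : (m.restrict S).real univ ≤ (1 + κ) * μ.real univ := by
    have := ENNReal.toReal_mono (measure_ne_top _ univ) (h₂ univ)
    rw [hu] at this
    simpa [measureReal_def, ENNReal.toReal_ofReal (by linarith : 0 ≤ 1 + κ)] using this
  have hc : StronglyMeasurable fun x => F₀ (p x) := hF₀.comp_measurable hp
  have hi₀ : Integrable (fun x => F₀ (p x)) (m.restrict S) :=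
    Integrable.of_bound hc.aestronglyMeasurable K (Eventually.of_forall fun x => hK _)
  have hdiff : ∀ᵐ x ∂(m.restrict S), ‖F x - F₀ (p x)‖ ≤ δ :=
    (ae_restrict_iff' hS).2 (Eventually.of_forall hFF₀)
  have hid : Integrable (fun x => F x - F₀ (p x)) (m.restrict S) :=
    Integrable.of_bound (hF.sub hc).aestronglyMeasurable δ hdiff
  have hiF : Integrable F (m.restrict S) := 
    (hid.add hi₀).congr (Eventually.of_forall fun x => by simp)
  have hsupp : Function.support F ⊆ S := fun x hx => by
    by_contra h
    exact hx (hF0 x h)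
  refine ⟨(integrableOn_iff_integrable_of_support_subset hsupp).1 hiF, ?_⟩
  rw [← setIntegral_eq_integral_of_forall_compl_eq_zero (s := S) (fun x hx => hF0 x hx)]
  have e1 : ∫ x in S, F x ∂m - ∫ y, F₀ y ∂μ = ∫ x in S, (F x - F₀ (p x)) ∂m +
      (∫ y, F₀ y ∂((m.restrict S).map p) - ∫ y, F₀ y ∂μ) := by
    rw [integral_sub hiF hi₀, integral_map hp.aemeasurable hF₀.aestronglyMeasurable]
    abel
  rw [e1]
  calc _ ≤ δ * (m.restrict S).real univ + K * (κ * μ.real univ) :=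
        (norm_add_le _ _).trans (add_le_add (norm_integral_le_of_norm_le_const hdiff)
          (norm_integral_sub_integral_le_of_le hκ h₁ h₂ hF₀ hK))
    _ ≤ δ * ((1 + κ) * μ.real univ) + K * (κ * μ.real univ) := by gcongr
    _ = _ := by ring

theorem comap_subtype_val_euclideanHausdorffMeasure {X : Type*} [MetricSpace X] [MeasurableSpace X]
    [BorelSpace X] {M : Set X} (hM : MeasurableSet M) (d : ℕ) :
    Measure.comap (Subtype.val : M → X) μHE[d] = μHE[d] := by
  ext s hs
  rw [(MeasurableEmbedding.subtype_coe hM).comap_apply,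
    isometry_subtype_coe.euclideanHausdorffMeasure_image]

/-! ### Integrals of radial functions against linear and quadratic maps -/

section Radial

variable {T : Type*} [NormedAddCommGroup T] [InnerProductSpace ℝ T] [FiniteDimensional ℝ T]
  [MeasurableSpace T] [BorelSpace T] {ι : Type*} [Fintype ι]

theorem integral_radial_smul_self {G : Type*} [NormedAddCommGroup G] [NormedSpace ℝ G]
    (φ : ℝ → ℝ) (L : T →ₗ[ℝ] G) : ∫ y : T, φ ‖y‖ • L y = 0 := by
  have h := integral_neg_eq_self (fun y : T => φ ‖y‖ • L y) volume
  have : IsAddTorsionFree G := .of_isTorsionFree ℝ G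
  simp only [norm_neg, map_neg, smul_neg, integral_neg] at h
  exact self_eq_neg.1 h.symm

/-- Off-diagonal second moments of a radial density vanish, by reflection in a basis vector. -/
theorem integral_radial_mul_inner_mul_inner_of_ne (φ : ℝ → ℝ) (b : OrthonormalBasis ι ℝ T) {i j : ι}
    (hij : i ≠ j) : ∫ y : T, φ ‖y‖ * (inner ℝ (b i) y * inner ℝ (b j) y) = 0 := by
  let R := (ℝ ∙ b i)ᗮ.reflection
  have hi : ∀ y, inner ℝ (b i) (R y) = -inner ℝ (b i) y := fun y => by
    rw [← R.inner_map_map, Submodule.reflection_reflection,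
      Submodule.reflection_orthogonalComplement_singleton_eq_neg, inner_neg_left]
  have hj : ∀ y, inner ℝ (b j) (R y) = inner ℝ (b j) y := fun y => by
    rw [← R.inner_map_map, Submodule.reflection_reflection,
      Submodule.reflection_mem_subspace_eq_self]
    rw [Submodule.mem_orthogonal_singleton_iff_inner_right]
    exact b.orthonormal.2 hij
  have h := R.measurePreserving.integral_comp' (f := R.toMeasurableEquiv)
    (fun y : T => φ ‖y‖ * (inner ℝ (b i) y * inner ℝ (b j) y))
  simp only [LinearIsometryEquiv.coe_toMeasurableEquiv, hi, hj, LinearIsometryEquiv.norm_map, neg_mul, mul_neg, integral_neg] at h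
  exact self_eq_neg.1 h.symm

/-- Diagonal second moments of a radial density agree, by exchanging two basis vectors. -/
theorem integral_radial_mul_inner_sq_eq (φ : ℝ → ℝ) (b : OrthonormalBasis ι ℝ T) (i j : ι) :
    ∫ y : T, φ ‖y‖ * inner ℝ (b i) y ^ 2 = ∫ y : T, φ ‖y‖ * inner ℝ (b j) y ^ 2 := by
  classical
  let R := b.equiv b (Equiv.swap i j)
  have hi : ∀ y, inner ℝ (b j) (R y) = inner ℝ (b i) y := fun y => by
    have : b j = R (b i) := by simp [R]
    rw [this, R.inner_map_map]
  have h := R.measurePreserving.integral_comp' (f := R.toMeasurableEquiv)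
    (fun y : T => φ ‖y‖ * inner ℝ (b j) y ^ 2)
  simpa only [LinearIsometryEquiv.coe_toMeasurableEquiv, hi, LinearIsometryEquiv.norm_map] using h

theorem integral_radial_mul_inner_sq (φ : ℝ → ℝ) (b : OrthonormalBasis ι ℝ T)
    (hφ : Integrable fun y : T => φ ‖y‖ * ‖y‖ ^ 2) (hm : Measurable φ) (i : ι) :
    Fintype.card ι * ∫ y : T, φ ‖y‖ * inner ℝ (b i) y ^ 2 = ∫ y : T, φ ‖y‖ * ‖y‖ ^ 2 := by
  have hint : ∀ j, Integrable fun y : T => φ ‖y‖ * inner ℝ (b j) y ^ 2 := fun j => by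
    refine hφ.mono (by fun_prop) (Eventually.of_forall fun y => ?_)
    simp only [norm_mul, norm_pow, norm_norm]
    gcongr
    simpa using norm_inner_le_norm (𝕜 := ℝ) (b j) y
  calc _ = ∑ j, ∫ y : T, φ ‖y‖ * inner ℝ (b j) y ^ 2 := by
        rw [Finset.sum_congr rfl fun j _ => integral_radial_mul_inner_sq_eq φ b j i]
        simp
    _ = ∫ y : T, φ ‖y‖ * ‖y‖ ^ 2 := by
        rw [← integral_finsetSum _ fun j _ => hint j]
        refine integral_congr_ae (Eventually.of_forall fun y => ?_)
        simp only
        rw [← Finset.mul_sum, b.sum_sq_inner_right]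

/-- Against a radial density, a quadratic map integrates to its trace times the normalised second
moment of the density. -/
theorem integral_radial_smul_quadratic {G : Type*} [NormedAddCommGroup G] [NormedSpace ℝ G]
    [FiniteDimensional ℝ G] (φ : ℝ → ℝ) (b : OrthonormalBasis ι ℝ T)
    (hφ : Integrable fun y : T => φ ‖y‖ * ‖y‖ ^ 2) (hm : Measurable φ) (B : T →ₗ[ℝ] T →ₗ[ℝ] G) :
    (Fintype.card ι : ℝ) • ∫ y : T, φ ‖y‖ • B y y =
      (∫ y : T, φ ‖y‖ * ‖y‖ ^ 2) • ∑ i, B (b i) (b i) := by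
  have hB : ∀ y, φ ‖y‖ • B y y =
      ∑ i, ∑ j, (φ ‖y‖ * (inner ℝ (b i) y * inner ℝ (b j) y)) • B (b i) (b j) := fun y => by
    conv_lhs => rw [← b.sum_repr' y]
    simp only [map_sum, map_smul, LinearMap.sum_apply, LinearMap.smul_apply, Finset.smul_sum,
      smul_smul]
    rw [b.sum_repr' y, Finset.sum_comm]
    refine Finset.sum_congr rfl fun i _ => Finset.sum_congr rfl fun j _ => ?_
    congr 1
    ring
  have hint : ∀ i j, Integrable fun y : T => φ ‖y‖ * (inner ℝ (b i) y * inner ℝ (b j) y) :=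
    fun i j => by
      refine hφ.mono (by fun_prop) (Eventually.of_forall fun y => ?_)
      simp only [norm_mul, norm_norm, sq]
      gcongr
      · simpa using norm_inner_le_norm (𝕜 := ℝ) (b i) y
      · simpa using norm_inner_le_norm (𝕜 := ℝ) (b j) y
  simp_rw [hB]
  rw [integral_finsetSum _ fun i _ => integrable_finsetSum _ fun j _ => (hint i j).smul_const _,
    Finset.smul_sum, Finset.smul_sum]
  refine Finset.sum_congr rfl fun i _ => ?_
  rw [integral_finsetSum _ fun j _ => (hint i j).smul_const _, Finset.sum_eq_single i]
  · rw [integral_smul_const, smul_smul, ← integral_radial_mul_inner_sq φ b hφ hm i]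
    simp only [sq]
  · intro j _ hj
    rw [integral_smul_const, integral_radial_mul_inner_mul_inner_of_ne φ b hj.symm, zero_smul]
  · simp

end Radial

/-! ### Kernel profiles -/

/-- Quantitative consequences of `IsKernelPair` on the half-line: Lipschitz and sup bounds with a
common constant `A`, vanishing beyond `1`, and the relation between the profiles. -/
structure KernelBounds (n : ℕ) (ρ ξ : ℝ → ℝ) (A : ℝ) : Prop where
  nonneg : 0 ≤ A
  deriv_lip : ∀ s t, |deriv ρ s - deriv ρ t| ≤ A * |s - t|
  deriv_zero : deriv ρ 0 = 0
  deriv_far : ∀ s, 1 ≤ s → deriv ρ s = 0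
  xi_lip : ∀ s t, |ξ s - ξ t| ≤ A * |s - t|
  xi_far : ∀ s, 1 ≤ s → ξ s = 0
  xi_bound : ∀ s, |ξ s| ≤ A
  relation : ∀ s, 0 ≤ s → s * deriv ρ s = -(n * ξ s)

theorem Varifold.IsKernelPair.exists_kernelBounds {n : ℕ} {ρ ξ : ℝ → ℝ} (h : IsKernelPair n ρ ξ) :
    ∃ A, KernelBounds n ρ ξ A := by
  have hρc : HasCompactSupport ρ := isCompact_Icc.of_isClosed_subset (isClosed_tsupport _)
    h.support_rho
  have hξc : HasCompactSupport ξ := isCompact_Icc.of_isClosed_subset (isClosed_tsupport _)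
    h.support_xi
  have hd : ContDiff ℝ ∞ (deriv ρ) := (contDiff_infty_iff_deriv.1 h.smooth_rho).2
  obtain ⟨A₁, hA₁⟩ := ContDiff.lipschitzWith_of_hasCompactSupport hρc.deriv hd (by simp)
  obtain ⟨A₂, hA₂⟩ := ContDiff.lipschitzWith_of_hasCompactSupport hξc h.smooth_xi (by simp)
  obtain ⟨A₃, hA₃⟩ := hξc.exists_bound_of_continuous h.smooth_xi.continuous
  -- a continuous function supported in `[-1, 1]` vanishes at the endpoint `1` as well
  have far : ∀ g : ℝ → ℝ, Continuous g → tsupport g ⊆ Icc (-1) 1 → ∀ s, 1 ≤ s → g s = 0 := by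
    intro g hg hs
    have h1 : ∀ s ∈ Ioi (1 : ℝ), g s = 0 := fun s hs' => by
      by_contra hne
      exact absurd (hs (subset_tsupport g hne)).2 (not_le.2 hs')
    intro s hs'
    have h2 : EqOn g 0 (closure (Ioi (1 : ℝ))) :=
      EqOn.closure (fun s hs => h1 s hs) hg continuous_const
    exact h2 (by simpa using hs')
  have hρfar := far _ hd.continuous ((tsupport_deriv_subset (𝕜 := ℝ) (f := ρ)).trans h.support_rho)
  have hξfar := far _ h.smooth_xi.continuous h.support_xi
  refine ⟨max A₁ (max A₂ A₃), le_max_of_le_left A₁.2, fun s t => ?_, ?_, hρfar, fun s t => ?_,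
    hξfar, fun s => ?_, fun s hs => ?_⟩
  · have := hA₁.dist_le_mul s t
    rw [Real.dist_eq, Real.dist_eq] at this
    exact this.trans (by gcongr; exact le_max_left _ _)
  · have e : (fun s => ρ (-s)) = ρ := funext h.even_rho
    have := deriv_comp_neg ρ 0
    rw [e, neg_zero] at this
    linarith
  · have := hA₂.dist_le_mul s t
    rw [Real.dist_eq, Real.dist_eq] at this
    exact this.trans (by gcongr; exact le_max_of_le_right (le_max_left _ _))
  · exact (hA₃ s).trans (le_max_of_le_right (le_max_right _ _))
  · rcases lt_or_ge s 1 with h1 | h1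
    · rw [h.relation s ⟨by linarith, h1⟩, neg_neg]
    · simp [hρfar s h1, hξfar s h1]

namespace KernelBounds

variable {n : ℕ} {ρ ξ : ℝ → ℝ} {A ε : ℝ}

theorem abs_div_le (h : KernelBounds n ρ ξ A) (hε : 0 < ε) (t : ℝ) :
    |deriv ρ (t / ε) / t| ≤ A / ε := by
  rcases eq_or_ne t 0 with rfl | ht
  · simpa using div_nonneg h.nonneg hε.le
  have := h.deriv_lip (t / ε) 0
  rw [h.deriv_zero, sub_zero, sub_zero, abs_div, abs_of_pos hε] at this
  rw [abs_div, div_le_iff₀ (abs_pos.2 ht)]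
  calc _ ≤ _ := this
    _ = _ := by ring

theorem div_mul_self (h : KernelBounds n ρ ξ A) (t : ℝ) :
    deriv ρ (t / ε) / t * t = deriv ρ (t / ε) := by
  rcases eq_or_ne t 0 with rfl | ht
  · simp [h.deriv_zero]
  · exact div_mul_cancel₀ _ ht

theorem abs_div_sub_div_mul_le (h : KernelBounds n ρ ξ A) (hε : 0 < ε) (t : ℝ) {u : ℝ}
    (hu : 0 ≤ u) :
    |deriv ρ (t / ε) / t - deriv ρ (u / ε) / u| * u ≤ 2 * A / ε * |t - u| := by
  have e : (deriv ρ (t / ε) / t - deriv ρ (u / ε) / u) * u =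
      (deriv ρ (t / ε) - deriv ρ (u / ε)) + deriv ρ (t / ε) / t * (u - t) := by
    rw [sub_mul, mul_sub, h.div_mul_self, h.div_mul_self]
    ring
  have h1 := h.deriv_lip (t / ε) (u / ε)
  rw [← sub_div, abs_div, abs_of_pos hε] at h1
  have h2 := mul_le_mul_of_nonneg_right (h.abs_div_le hε t) (abs_nonneg (u - t))
  rw [← abs_mul] at h2
  calc _ = |(deriv ρ (t / ε) / t - deriv ρ (u / ε) / u) * u| := by rw [abs_mul, abs_of_nonneg hu]
    _ ≤ A * (|t - u| / ε) + A / ε * |u - t| := by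
        rw [e]; exact (abs_add_le _ _).trans (add_le_add h1 h2)
    _ = _ := by rw [abs_sub_comm u t]; ring

theorem div_mul_sq (h : KernelBounds n ρ ξ A) (hε : 0 < ε) {t : ℝ} (ht : 0 ≤ t) :
    deriv ρ (t / ε) / t * t ^ 2 = -(n * ε) * ξ (t / ε) := by
  have := h.relation (t / ε) (by positivity)
  rw [sq, ← mul_assoc, h.div_mul_self]
  field_simp at this
  linear_combination this

theorem deriv_comp_div_eq_zero (h : KernelBounds n ρ ξ A) (hε : 0 < ε) {t : ℝ} (ht : ε ≤ t) :
    deriv ρ (t / ε) = 0 := h.deriv_far _ ((one_le_div hε).2 ht)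

theorem xi_comp_div_eq_zero (h : KernelBounds n ρ ξ A) (hε : 0 < ε) {t : ℝ} (ht : ε ≤ t) :
    ξ (t / ε) = 0 := h.xi_far _ ((one_le_div hε).2 ht)

end KernelBounds

theorem integral_comp_norm_div {T : Type*} [NormedAddCommGroup T] [InnerProductSpace ℝ T]
    [FiniteDimensional ℝ T] [MeasurableSpace T] [BorelSpace T] (ξ : ℝ → ℝ) {ε : ℝ} (hε : 0 < ε) :
    ∫ y : T, ξ (‖y‖ / ε) = ε ^ Module.finrank ℝ T * ∫ y : T, ξ ‖y‖ := by
  have := Measure.integral_comp_inv_smul_of_nonneg (volume : Measure T) (fun y => ξ ‖y‖) hε.le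
  simpa [norm_smul, abs_of_pos hε, div_eq_inv_mul] using this

/-- In positive dimension the profile `ξ`, positive on `(0, 1)`, has positive integral. -/
theorem Varifold.IsKernelPair.integral_xi_pos {T : Type*} [NormedAddCommGroup T] [InnerProductSpace ℝ T]
    [FiniteDimensional ℝ T] [MeasurableSpace T] [BorelSpace T] [Nontrivial T] {n : ℕ}
    {ρ ξ : ℝ → ℝ} (h : IsKernelPair n ρ ξ) : 0 < ∫ y : T, ξ ‖y‖ := by
  obtain ⟨y, hy⟩ := exists_norm_eq T (c := 1 / 2) (by norm_num)
  refine Continuous.integral_pos_of_hasCompactSupport_nonneg_nonzero (x := y)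
    (h.smooth_xi.continuous.comp continuous_norm) ?_ (fun y => h.nonneg_xi _) ?_
  · refine HasCompactSupport.intro (isCompact_closedBall (0 : T) 1) fun y hy => ?_
    by_contra hne
    exact hy (by simpa using (h.support_xi (subset_tsupport ξ hne)).2)
  · exact (h.pos_xi ‖y‖ (by rw [hy]; norm_num)).ne'

/-! ### A hypersurface near one of its points -/

theorem starProjection_orthogonal_span_unit {E : Type*} [NormedAddCommGroup E]
    [InnerProductSpace ℝ E] {ν : E} (hν : ‖ν‖ = 1) (z : E) :
    (ℝ ∙ ν)ᗮ.starProjection z = z - inner ℝ ν z • ν := by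
  rw [Submodule.starProjection_orthogonal']
  simp [Submodule.starProjection_unit_singleton ℝ hν]

theorem norm_sq_eq_starProjection_add_inner {E : Type*} [NormedAddCommGroup E]
    [InnerProductSpace ℝ E] {ν : E} (hν : ‖ν‖ = 1) (z : E) :
    ‖z‖ ^ 2 = ‖(ℝ ∙ ν)ᗮ.starProjection z‖ ^ 2 + inner ℝ ν z ^ 2 := by
  rw [starProjection_orthogonal_span_unit hν, norm_sub_sq_real, norm_smul, hν, inner_smul_right,
    real_inner_comm, Real.norm_eq_abs, mul_one, sq_abs]
  ring

/-- `M` is described near `x₀ ∈ M` by the equation `f = 0`, where `f` is normalised so that its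
gradient at `x₀` is the unit normal `ν`. The constant `C` bounds both the Lipschitz constant at `x₀`
of `Df` on the ball of radius `R` and the symmetric bilinear form `b`, which plays the role of
`D²f(x₀)`. -/
structure IsNormalChart {E : Type*} [NormedAddCommGroup E] [InnerProductSpace ℝ E] (M : Set E)
    (x₀ ν : E) (f : E → ℝ) (b : E →L[ℝ] E →L[ℝ] ℝ) (R C : ℝ) : Prop where
  norm_normal : ‖ν‖ = 1
  radius_pos : 0 < R
  const_nonneg : 0 ≤ C
  radius_small : C * R ≤ 1 / 4
  base_mem : x₀ ∈ M
  mem_iff : ∀ x, ‖x - x₀‖ < R → (x ∈ M ↔ f x = 0)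
  differentiableAt : ∀ x, ‖x - x₀‖ < R → DifferentiableAt ℝ f x
  norm_fderiv_sub_le : ∀ x, ‖x - x₀‖ < R → ‖fderiv ℝ f x - innerSL ℝ ν‖ ≤ C * ‖x - x₀‖
  symm : ∀ v w, b v w = b w v
  norm_hess_le : ‖b‖ ≤ C

/-- `Df` differs on the ball of radius `r` from its affine model `⟨ν, ·⟩ + b(x - x₀, ·)` by at most
`η r`. For a `C²` function `η` may be taken arbitrarily small with `r`; for a `C³` function it may be
taken proportional to `r`. -/
def FDerivApprox {E : Type*} [NormedAddCommGroup E] [InnerProductSpace ℝ E] (x₀ ν : E) (f : E → ℝ)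
    (b : E →L[ℝ] E →L[ℝ] ℝ) (η r : ℝ) : Prop :=
  ∀ x, ‖x - x₀‖ ≤ r → ‖fderiv ℝ f x - innerSL ℝ ν - b (x - x₀)‖ ≤ η * r

namespace IsNormalChart

variable {E : Type*} [NormedAddCommGroup E] [InnerProductSpace ℝ E] {M : Set E} {x₀ ν x x' : E}
  {f : E → ℝ} {b : E →L[ℝ] E →L[ℝ] ℝ} {R C r η : ℝ}

theorem apply_base (h : IsNormalChart M x₀ ν f b R C) : f x₀ = 0 :=
  (h.mem_iff x₀ (by simpa using h.radius_pos)).1 h.base_mem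

theorem abs_sub_sub_inner_le (h : IsNormalChart M x₀ ν f b R C) (hr : r < R)
    (hx : ‖x - x₀‖ ≤ r) (hx' : ‖x' - x₀‖ ≤ r) :
    |f x - f x' - inner ℝ ν (x - x')| ≤ C * r * ‖x - x'‖ := by
  have := (convex_closedBall x₀ r).norm_image_sub_le_of_norm_fderiv_le' (𝕜 := ℝ) (f := f)
    (φ := innerSL ℝ ν) (C := C * r) (x := x') (y := x)
    (fun y hy => h.differentiableAt y (lt_of_le_of_lt (by simpa [dist_eq_norm] using hy) hr))
    (fun y hy => (h.norm_fderiv_sub_le y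
      (lt_of_le_of_lt (by simpa [dist_eq_norm] using hy) hr)).trans
        (mul_le_mul_of_nonneg_left (by simpa [dist_eq_norm] using hy) h.const_nonneg))
    (by simpa [dist_eq_norm] using hx') (by simpa [dist_eq_norm] using hx)
  simpa using this

theorem abs_sub_inner_le (h : IsNormalChart M x₀ ν f b R C) (hx : ‖x - x₀‖ < R) :
    |f x - inner ℝ ν (x - x₀)| ≤ C * ‖x - x₀‖ ^ 2 := by
  have := h.abs_sub_sub_inner_le hx le_rfl (x' := x₀) (by simp)
  rw [h.apply_base, sub_zero] at this
  linarith

theorem abs_inner_le (h : IsNormalChart M x₀ ν f b R C) (hM : x ∈ M) (hx : ‖x - x₀‖ < R) :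
    |inner ℝ ν (x - x₀)| ≤ C * ‖x - x₀‖ ^ 2 := by
  have := h.abs_sub_inner_le hx
  rwa [(h.mem_iff x hx).1 hM, zero_sub, abs_neg] at this

theorem norm_le_two_mul (h : IsNormalChart M x₀ ν f b R C) (hM : x ∈ M) (hx : ‖x - x₀‖ < R) :
    ‖x - x₀‖ ≤ 2 * ‖(ℝ ∙ ν)ᗮ.starProjection (x - x₀)‖ := by
  have h1 := h.abs_inner_le hM hx
  have h2 := norm_sq_eq_starProjection_add_inner h.norm_normal (x - x₀)
  have h3 : C * ‖x - x₀‖ ≤ 1 / 4 :=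
    (mul_le_mul_of_nonneg_left hx.le h.const_nonneg).trans h.radius_small
  have h4 : |inner ℝ ν (x - x₀)| ≤ 1 / 4 * ‖x - x₀‖ :=
    h1.trans (by rw [sq, ← mul_assoc]; gcongr)
  have h5 : inner ℝ ν (x - x₀) ^ 2 ≤ (1 / 4 * ‖x - x₀‖) ^ 2 := sq_le_sq' (abs_le.1 h4).1 (abs_le.1 h4).2
  refine (sq_le_sq₀ (norm_nonneg _) (by positivity)).1 ?_
  nlinarith [sq_nonneg ‖x - x₀‖, sq_nonneg ‖(ℝ ∙ ν)ᗮ.starProjection (x - x₀)‖]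

/-- The height over the tangent plane is quadratic, so the distance to `x₀` and that of the
projection differ only at third order. -/
theorem abs_norm_sub_norm_starProjection_le (h : IsNormalChart M x₀ ν f b R C) (hM : x ∈ M)
    (hx : ‖x - x₀‖ < R) :
    |‖x - x₀‖ - ‖(ℝ ∙ ν)ᗮ.starProjection (x - x₀)‖| ≤
      16 * C ^ 2 * ‖(ℝ ∙ ν)ᗮ.starProjection (x - x₀)‖ ^ 3 := by
  have h1 := h.abs_inner_le hM hx
  have h2 := norm_sq_eq_starProjection_add_inner h.norm_normal (x - x₀)
  have h3 := h.norm_le_two_mul hM hx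
  set y := ‖(ℝ ∙ ν)ᗮ.starProjection (x - x₀)‖ with hy
  set z := ‖x - x₀‖ with hz
  have hy0 : 0 ≤ y := norm_nonneg _
  have hz0 : 0 ≤ z := norm_nonneg _
  have hyz : y ≤ z := (sq_le_sq₀ hy0 hz0).1 (by nlinarith [sq_nonneg (inner ℝ ν (x - x₀))])
  rw [abs_of_nonneg (sub_nonneg.2 hyz)]
  have h5 : |inner ℝ ν (x - x₀)| ≤ C * (2 * y) ^ 2 := h1.trans (by gcongr; exact h.const_nonneg)
  have h4 : inner ℝ ν (x - x₀) ^ 2 ≤ (C * (2 * y) ^ 2) ^ 2 :=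
    sq_le_sq' (abs_le.1 h5).1 (abs_le.1 h5).2
  rcases hy0.eq_or_lt with h0 | h0
  · rw [← h0] at h3 ⊢
    have : z = 0 := le_antisymm (by linarith) hz0
    simp [this]
  · refine le_of_mul_le_mul_right ?_ h0
    nlinarith

/-- Near `x₀` the hypersurface is a graph over its tangent plane with a gradient of order `r`, so
that the inverse of the projection is Lipschitz with constant `1 + O(r²)`. -/
theorem norm_sub_le_starProjection (h : IsNormalChart M x₀ ν f b R C) (hr : r < R) (hr0 : 0 ≤ r)
    (hM : x ∈ M) (hx : ‖x - x₀‖ ≤ r) (hM' : x' ∈ M) (hx' : ‖x' - x₀‖ ≤ r) :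
    ‖x - x'‖ ≤ (1 + C ^ 2 * r ^ 2) * ‖(ℝ ∙ ν)ᗮ.starProjection (x - x')‖ := by
  have h1 := h.abs_sub_sub_inner_le hr hx hx'
  rw [(h.mem_iff x (hx.trans_lt hr)).1 hM, (h.mem_iff x' (hx'.trans_lt hr)).1 hM', sub_zero,
    zero_sub, abs_neg] at h1
  have h2 := norm_sq_eq_starProjection_add_inner h.norm_normal (x - x')
  have h4 := sq_le_sq' (abs_le.1 h1).1 (abs_le.1 h1).2
  have h3 : C * r ≤ 1 / 4 :=
    (mul_le_mul_of_nonneg_left hr.le h.const_nonneg).trans h.radius_small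
  have h30 : 0 ≤ C * r := mul_nonneg h.const_nonneg hr0
  rw [← mul_pow]
  generalize C * r = u at *
  refine (sq_le_sq₀ (norm_nonneg _) (by positivity)).1 ?_
  have hu : u ^ 2 ≤ 1 / 16 := by nlinarith
  have h5 : (1 - u ^ 2) * ‖x - x'‖ ^ 2 ≤ ‖(ℝ ∙ ν)ᗮ.starProjection (x - x')‖ ^ 2 := by
    rw [mul_pow] at h4
    linarith
  -- `(1 + w)² (1 - w) ≥ 1` for small `w = u²`
  have h6 : 1 ≤ (1 + u ^ 2) ^ 2 * (1 - u ^ 2) := by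
    nlinarith [sq_nonneg u, mul_nonneg (sq_nonneg u) (sq_nonneg u)]
  calc ‖x - x'‖ ^ 2 ≤ (1 + u ^ 2) ^ 2 * (1 - u ^ 2) * ‖x - x'‖ ^ 2 :=
        le_mul_of_one_le_left (sq_nonneg _) h6
    _ = (1 + u ^ 2) ^ 2 * ((1 - u ^ 2) * ‖x - x'‖ ^ 2) := by ring
    _ ≤ (1 + u ^ 2) ^ 2 * ‖(ℝ ∙ ν)ᗮ.starProjection (x - x')‖ ^ 2 := by gcongr
    _ = _ := by ring

theorem exists_mem_of_starProjection (h : IsNormalChart M x₀ ν f b R C) {y : E}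
    (hy : y ∈ (ℝ ∙ ν)ᗮ) (hyR : 2 * ‖y‖ < R) :
    ∃ x ∈ M, ‖x - x₀‖ < R ∧ (ℝ ∙ ν)ᗮ.starProjection (x - x₀) = y := by
  have hyν : inner ℝ ν y = 0 := Submodule.mem_orthogonal_singleton_iff_inner_right.1 hy
  have hνν : inner ℝ ν ν = (1 : ℝ) := by simp [h.norm_normal]
  let g : ℝ → E := fun t => x₀ + (y + t • ν)
  have hg : ∀ t, g t - x₀ = y + t • ν := fun t => by simp [g]
  have hin : ∀ t, inner ℝ ν (g t - x₀) = t := fun t => by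
    rw [hg, inner_add_right, inner_smul_right, hyν, hνν]; simp
  have hnorm : ∀ t ∈ Icc (-‖y‖) ‖y‖, ‖g t - x₀‖ ≤ 2 * ‖y‖ := fun t ht => by
    rw [hg]
    refine (norm_add_le _ _).trans ?_
    rw [norm_smul, h.norm_normal, mul_one, Real.norm_eq_abs]
    linarith [abs_le.2 ht]
  have hcont : ContinuousOn (fun t => f (g t)) (Icc (-‖y‖) ‖y‖) := fun t ht =>
    ((h.differentiableAt (g t) ((hnorm t ht).trans_lt hyR)).continuousAt.comp
      (f := g) (by fun_prop : Continuous g).continuousAt).continuousWithinAt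
  have hsmall : ∀ t ∈ Icc (-‖y‖) ‖y‖, |f (g t) - t| ≤ ‖y‖ := fun t ht => by
    have h1 := h.abs_sub_inner_le ((hnorm t ht).trans_lt hyR)
    rw [hin] at h1
    have h2 : C * ‖g t - x₀‖ ^ 2 ≤ C * (2 * ‖y‖) ^ 2 := by
      gcongr
      · exact h.const_nonneg
      · exact hnorm t ht
    have h3 : C * (2 * ‖y‖) ≤ 1 / 4 :=
      (mul_le_mul_of_nonneg_left hyR.le h.const_nonneg).trans h.radius_small
    nlinarith [norm_nonneg y]
  have hle : -‖y‖ ≤ ‖y‖ := by linarith [norm_nonneg y]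
  obtain ⟨t, ht, h0⟩ := intermediate_value_Icc hle hcont
    (show (0 : ℝ) ∈ Icc (f (g (-‖y‖))) (f (g ‖y‖)) by
      have h1 := abs_le.1 (hsmall _ (left_mem_Icc.2 hle))
      have h2 := abs_le.1 (hsmall _ (right_mem_Icc.2 hle))
      constructor <;> linarith)
  have htR := (hnorm t ht).trans_lt hyR
  refine ⟨g t, (h.mem_iff _ htR).2 h0, htR, ?_⟩
  rw [starProjection_orthogonal_span_unit h.norm_normal, hin, hg, add_sub_cancel_right]

/-- Second order Taylor expansion of `f` at `x₀`, read on the hypersurface. -/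
theorem abs_inner_add_half_hess_le (h : IsNormalChart M x₀ ν f b R C) (hr : r < R) (hη : 0 ≤ η)
    (ha : FDerivApprox x₀ ν f b η r) (hM : x ∈ M) (hx : ‖x - x₀‖ ≤ r) :
    |inner ℝ ν (x - x₀) + 1 / 2 * b (x - x₀) (x - x₀)| ≤ η * r ^ 2 := by
  have hr0 : 0 ≤ r := (norm_nonneg _).trans hx
  let g : E → ℝ := fun y => f y - 1 / 2 * b (y - x₀) (y - x₀)
  have hg : ∀ y, ‖y - x₀‖ ≤ r → HasFDerivAt g (fderiv ℝ f y - b (y - x₀)) y := fun y hy => by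
    have h1 := (h.differentiableAt y (hy.trans_lt hr)).hasFDerivAt
    have h2 : HasFDerivAt (fun y : E => y - x₀) (ContinuousLinearMap.id ℝ E) y :=
      (hasFDerivAt_id y).sub_const x₀
    have h3 := ((b.hasFDerivAt_of_bilinear h2 h2).const_mul (1 / 2 : ℝ))
    refine (h1.sub h3).congr_fderiv ?_
    ext v
    simp [h.symm v]
    ring
  have := (convex_closedBall x₀ r).norm_image_sub_le_of_norm_hasFDerivWithin_le' (f := g)
    (φ := innerSL ℝ ν) (C := η * r) (x := x₀) (y := x)
    (fun y hy => (hg y (by simpa [dist_eq_norm] using hy)).hasFDerivWithinAt)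
    (fun y hy => by
      have := ha y (by simpa [dist_eq_norm] using hy)
      rwa [sub_right_comm] at this)
    (by simpa using hr0) (by simpa [dist_eq_norm] using hx)
  simp only [g, h.apply_base, (h.mem_iff x (hx.trans_lt hr)).1 hM, sub_self, map_zero, mul_zero,
    sub_zero, zero_sub, innerSL_apply_apply, Real.norm_eq_abs] at this
  rw [← neg_add', abs_neg, add_comm] at this
  refine this.trans ?_
  rw [sq, ← mul_assoc]
  gcongr

theorem norm_sub_starProjection_le (h : IsNormalChart M x₀ ν f b R C) (hr : r < R)
    (hM : x ∈ M) (hx : ‖x - x₀‖ ≤ r) :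
    ‖x - x₀ - (ℝ ∙ ν)ᗮ.starProjection (x - x₀)‖ ≤ C * r ^ 2 := by
  rw [starProjection_orthogonal_span_unit h.norm_normal, sub_sub_cancel, norm_smul, h.norm_normal,
    mul_one, Real.norm_eq_abs]
  refine (h.abs_inner_le hM (hx.trans_lt hr)).trans ?_
  gcongr
  exact h.const_nonneg

theorem abs_half_hess_sub_le (h : IsNormalChart M x₀ ν f b R C) (hr : r < R)
    (hM : x ∈ M) (hx : ‖x - x₀‖ ≤ r) :
    |1 / 2 * b (x - x₀) (x - x₀) - 1 / 2 * b ((ℝ ∙ ν)ᗮ.starProjection (x - x₀))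
      ((ℝ ∙ ν)ᗮ.starProjection (x - x₀))| ≤ C ^ 2 * r ^ 3 := by
  have h1 := h.norm_sub_starProjection_le hr hM hx
  have h2 : ‖(ℝ ∙ ν)ᗮ.starProjection (x - x₀)‖ ≤ r :=
    (Submodule.norm_starProjection_apply_le _ _).trans hx
  generalize x - x₀ = z at *
  generalize (ℝ ∙ ν)ᗮ.starProjection z = y at *
  have hC := h.const_nonneg
  have e : 1 / 2 * b z z - 1 / 2 * b y y = 1 / 2 * b z (z - y) + 1 / 2 * b (z - y) y := by
    simp only [map_sub, sub_apply]; ring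
  have h3 : |b z (z - y)| ≤ C * r * (C * r ^ 2) := by
    refine (b.le_opNorm₂ z (z - y)).trans ?_
    have := h.norm_hess_le
    have hr0 : 0 ≤ r := (norm_nonneg _).trans hx
    gcongr
  have h4 : |b (z - y) y| ≤ C * (C * r ^ 2) * r := by
    refine (b.le_opNorm₂ (z - y) y).trans ?_
    have := h.norm_hess_le
    gcongr
  rw [e]
  refine (abs_add_le _ _).trans ?_
  rw [abs_mul, abs_mul, abs_of_pos (by norm_num : (0 : ℝ) < 1 / 2)]
  nlinarith

end IsNormalChart

theorem starProjection_orthogonal_ker {n : ℕ} (L : EuclideanSpace ℝ (Fin n) →L[ℝ] ℝ)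
    (z : EuclideanSpace ℝ (Fin n)) :
    L.kerᗮ.starProjection z = (L z / ‖(InnerProductSpace.toDual ℝ _).symm L‖ ^ 2) •
      (InnerProductSpace.toDual ℝ _).symm L := by
  have aux : ∀ S : Submodule ℝ (EuclideanSpace ℝ (Fin n)),
      S = (ℝ ∙ (InnerProductSpace.toDual ℝ _).symm L)ᗮ →
      Sᗮ.starProjection z = (L z / ‖(InnerProductSpace.toDual ℝ _).symm L‖ ^ 2) •
        (InnerProductSpace.toDual ℝ _).symm L := by
    rintro S rfl
    rw [Submodule.starProjection_orthogonal', Submodule.starProjection_orthogonal']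
    simp [Submodule.starProjection_singleton]
  exact aux _ (ker_eq_orthogonal L)

theorem starProjection_ker {n : ℕ} (L : EuclideanSpace ℝ (Fin n) →L[ℝ] ℝ)
    (z : EuclideanSpace ℝ (Fin n)) :
    L.ker.starProjection z = z - (L z / ‖(InnerProductSpace.toDual ℝ _).symm L‖ ^ 2) •
      (InnerProductSpace.toDual ℝ _).symm L := by
  rw [← starProjection_orthogonal_ker, Submodule.starProjection_orthogonal']
  simp

theorem norm_inversion_sub_le {E : Type*} [NormedAddCommGroup E] [InnerProductSpace ℝ E] {g ν : E}
    (hν : ‖ν‖ = 1) (hg : g ≠ 0) : ‖(‖g‖ ^ 2)⁻¹ • g - ν‖ = ‖g - ν‖ / ‖g‖ := by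
  have hg' : ‖g‖ ≠ 0 := norm_ne_zero_iff.2 hg
  rw [eq_div_iff hg', ← sq_eq_sq₀ (by positivity) (by positivity), mul_pow, norm_sub_sq_real,
    norm_sub_sq_real, norm_smul, hν, inner_smul_left]
  simp
  field_simp
  ring

/-- On the hypersurface `⟨x - x₀, ∇f(x)⟩ = ½ D²f(y, y)` up to third order, `y` being the tangential
part of `x - x₀`: the sign is opposite to that of the height `⟨x - x₀, ν⟩`. -/
theorem IsNormalChart.norm_starProjection_ker_sub_le {n : ℕ}
    {M : Set (EuclideanSpace ℝ (Fin n))} {x₀ ν x : EuclideanSpace ℝ (Fin n)}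
    {f : EuclideanSpace ℝ (Fin n) → ℝ}
    {b : EuclideanSpace ℝ (Fin n) →L[ℝ] EuclideanSpace ℝ (Fin n) →L[ℝ] ℝ} {R C r η : ℝ}
    (h : IsNormalChart M x₀ ν f b R C) (hr : r < R) (hη : 0 ≤ η)
    (ha : FDerivApprox x₀ ν f b η r) (hM : x ∈ M) (hx : ‖x - x₀‖ ≤ r) :
    ‖(fderiv ℝ f x).kerᗮ.starProjection (x - x₀) -
      (1 / 2 * b ((ℝ ∙ ν)ᗮ.starProjection (x - x₀)) ((ℝ ∙ ν)ᗮ.starProjection (x - x₀))) • ν‖ ≤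
      4 * (η * r ^ 2 + C ^ 2 * r ^ 3) := by
  have hC := h.const_nonneg
  have hr0 : 0 ≤ r := (norm_nonneg _).trans hx
  have hCr : C * r ≤ 1 / 4 := (mul_le_mul_of_nonneg_left hr.le hC).trans h.radius_small
  have h1 := h.abs_inner_add_half_hess_le hr hη ha hM hx
  have h2 := h.abs_half_hess_sub_le hr hM hx
  have hy : ‖(ℝ ∙ ν)ᗮ.starProjection (x - x₀)‖ ≤ r :=
    (Submodule.norm_starProjection_apply_le _ _).trans hx
  have h3 : |fderiv ℝ f x (x - x₀) - inner ℝ ν (x - x₀) - b (x - x₀) (x - x₀)| ≤ η * r ^ 2 := by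
    refine ((fderiv ℝ f x - innerSL ℝ ν - b (x - x₀)).le_opNorm (x - x₀)).trans ?_
    calc _ ≤ η * r * r := by gcongr; exact ha x hx
      _ = _ := by ring
  set β := 1 / 2 * b ((ℝ ∙ ν)ᗮ.starProjection (x - x₀)) ((ℝ ∙ ν)ᗮ.starProjection (x - x₀)) with hβ
  have h4 : |fderiv ℝ f x (x - x₀) - β| ≤ 2 * η * r ^ 2 + C ^ 2 * r ^ 3 := by
    rw [abs_le] at *
    constructor <;> linarith [h1.1, h1.2, h2.1, h2.2, h3.1, h3.2]
  have h5 : |β| ≤ C * r ^ 2 := by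
    have : |b ((ℝ ∙ ν)ᗮ.starProjection (x - x₀)) ((ℝ ∙ ν)ᗮ.starProjection (x - x₀))| ≤ C * r * r := by
      refine (b.le_opNorm₂ _ _).trans ?_
      have := h.norm_hess_le
      gcongr
    rw [hβ, abs_mul, abs_of_pos (by norm_num : (0 : ℝ) < 1 / 2)]
    nlinarith [mul_nonneg hC (sq_nonneg r)]
  rw [starProjection_orthogonal_ker]
  set g := (InnerProductSpace.toDual ℝ _).symm (fderiv ℝ f x) with hg
  have hgν : ‖g - ν‖ ≤ C * r := by
    have : g - ν = (InnerProductSpace.toDual ℝ _).symm (fderiv ℝ f x - innerSL ℝ ν) := by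
      rw [map_sub, hg]
      congr 1
      exact ((InnerProductSpace.toDual ℝ _).symm_apply_apply ν).symm
    rw [this, LinearIsometryEquiv.norm_map]
    exact (h.norm_fderiv_sub_le x (hx.trans_lt hr)).trans (by gcongr)
  have hg34 : 3 / 4 ≤ ‖g‖ := by
    have := norm_sub_norm_le ν g
    rw [norm_sub_rev, h.norm_normal] at this
    linarith
  have hg0 : g ≠ 0 := norm_pos_iff.1 (by linarith)
  have h6 : ‖(‖g‖ ^ 2)⁻¹ • g - ν‖ ≤ 2 * (C * r) := by
    rw [norm_inversion_sub_le h.norm_normal hg0, div_le_iff₀ (by linarith)]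
    nlinarith [mul_nonneg hC hr0]
  have h7 : ‖(‖g‖ ^ 2)⁻¹ • g‖ ≤ 2 := by
    have := norm_le_norm_add_norm_sub ν ((‖g‖ ^ 2)⁻¹ • g)
    rw [norm_sub_rev, h.norm_normal] at this
    linarith
  have e : (fderiv ℝ f x (x - x₀) / ‖g‖ ^ 2) • g - β • ν =
      (fderiv ℝ f x (x - x₀) - β) • ((‖g‖ ^ 2)⁻¹ • g) + β • ((‖g‖ ^ 2)⁻¹ • g - ν) := by
    rw [smul_sub, sub_smul, smul_smul, div_eq_mul_inv]
    abel
  rw [e]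
  calc _ ≤ (2 * η * r ^ 2 + C ^ 2 * r ^ 3) * 2 + C * r ^ 2 * (2 * (C * r)) := by
        refine (norm_add_le _ _).trans ?_
        rw [norm_smul (_ - β), norm_smul β, Real.norm_eq_abs, Real.norm_eq_abs]
        gcongr
    _ = _ := by ring

/-- For each of the six projections, `Π(x - x₀)` is a multiple of the tangential part `y` of
`x - x₀` plus the second fundamental form `-D²f(y, y) ν`, up to third order. -/
theorem exists_norm_projectionChoice_sub_le {d : ℕ} {ν : EuclideanSpace ℝ (Fin (d + 1))}
    {P : EuclideanSpace ℝ (Fin (d + 1)) × Grassmannian d (d + 1) →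
      (EuclideanSpace ℝ (Fin (d + 1)) →L[ℝ] EuclideanSpace ℝ (Fin (d + 1)))}
    (hP : P ∈ projectionChoices d (ℝ ∙ ν)ᗮᗮ) :
    ∃ l : ℝ, |l| ≤ 2 ∧ ∀ {M : Set (EuclideanSpace ℝ (Fin (d + 1)))}
      {x₀ x : EuclideanSpace ℝ (Fin (d + 1))} {f : EuclideanSpace ℝ (Fin (d + 1)) → ℝ}
      {b : EuclideanSpace ℝ (Fin (d + 1)) →L[ℝ] EuclideanSpace ℝ (Fin (d + 1)) →L[ℝ] ℝ}
      {R C r η : ℝ} (S : Grassmannian d (d + 1)), IsNormalChart M x₀ ν f b R C → r < R → 0 ≤ η →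
      FDerivApprox x₀ ν f b η r → x ∈ M → ‖x - x₀‖ ≤ r → S.1 = (fderiv ℝ f x).ker →
      ‖P (x, S) (x - x₀) - (l • (ℝ ∙ ν)ᗮ.starProjection (x - x₀) -
        b ((ℝ ∙ ν)ᗮ.starProjection (x - x₀)) ((ℝ ∙ ν)ᗮ.starProjection (x - x₀)) • ν)‖ ≤
        10 * (η * r ^ 2 + C ^ 2 * r ^ 3) := by
  -- the two expansions from which all six follow by linearity
  have key : ∀ {M : Set (EuclideanSpace ℝ (Fin (d + 1)))}
      {x₀ x : EuclideanSpace ℝ (Fin (d + 1))} {f : EuclideanSpace ℝ (Fin (d + 1)) → ℝ}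
      {b : EuclideanSpace ℝ (Fin (d + 1)) →L[ℝ] EuclideanSpace ℝ (Fin (d + 1)) →L[ℝ] ℝ}
      {R C r η : ℝ} (S : Grassmannian d (d + 1)), IsNormalChart M x₀ ν f b R C → r < R → 0 ≤ η →
      FDerivApprox x₀ ν f b η r → x ∈ M → ‖x - x₀‖ ≤ r → S.1 = (fderiv ℝ f x).ker →
      ∃ (y u v : EuclideanSpace ℝ (Fin (d + 1))) (β : ℝ), (ℝ ∙ ν)ᗮ.starProjection (x - x₀) = y ∧
        b y y = β ∧ (ℝ ∙ ν)ᗮ.starProjection y = y ∧ (ℝ ∙ ν)ᗮ.starProjection ν = 0 ∧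
        x - x₀ = y - (1 / 2 * β) • ν + u ∧ S.1ᗮ.starProjection (x - x₀) = (1 / 2 * β) • ν + v ∧
        ‖u‖ ≤ η * r ^ 2 + C ^ 2 * r ^ 3 ∧ ‖v‖ ≤ 4 * (η * r ^ 2 + C ^ 2 * r ^ 3) := by
    intro M x₀ x f b R C r η S h hr hη ha hM hx hS
    have h1 := h.abs_inner_add_half_hess_le hr hη ha hM hx
    have h2 := h.abs_half_hess_sub_le hr hM hx
    have h3 := h.norm_starProjection_ker_sub_le hr hη ha hM hx
    have hy := starProjection_orthogonal_span_unit h.norm_normal (x - x₀)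
    refine ⟨_, x - x₀ - ((ℝ ∙ ν)ᗮ.starProjection (x - x₀) - (1 / 2 *
      b ((ℝ ∙ ν)ᗮ.starProjection (x - x₀)) ((ℝ ∙ ν)ᗮ.starProjection (x - x₀))) • ν), _, _, rfl, rfl,
      ?_, ?_, by abel, (add_sub_cancel _ _).symm, ?_, by rw [hS]; exact h3⟩
    · exact Submodule.starProjection_eq_self_iff.2 (Submodule.starProjection_apply_mem _ _)
    · rw [starProjection_orthogonal_span_unit h.norm_normal]
      simp [h.norm_normal]
    · set β := b ((ℝ ∙ ν)ᗮ.starProjection (x - x₀)) ((ℝ ∙ ν)ᗮ.starProjection (x - x₀))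
      have e : x - x₀ - ((ℝ ∙ ν)ᗮ.starProjection (x - x₀) - (1 / 2 * β) • ν) =
          (inner ℝ ν (x - x₀) + 1 / 2 * β) • ν := by
        rw [hy, add_smul]; abel
      rw [e, norm_smul, h.norm_normal, mul_one, Real.norm_eq_abs]
      rw [abs_le] at *
      constructor <;> linarith [h1.1, h1.2, h2.1, h2.2]
  have hN : ∀ z, ‖(ℝ ∙ ν)ᗮᗮ.starProjection z‖ ≤ ‖z‖ := Submodule.norm_starProjection_apply_le _
  have hN' : ∀ z, (ℝ ∙ ν)ᗮᗮ.starProjection z = z - (ℝ ∙ ν)ᗮ.starProjection z := fun z => by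
    rw [Submodule.starProjection_orthogonal' (U := (ℝ ∙ ν)ᗮ)]; simp
  rcases hP with rfl | rfl | rfl | rfl | rfl | rfl
  · refine ⟨1, by norm_num, ?_⟩
    intro M x₀ x f b R C r η S h hr hη ha hM hx hS
    obtain ⟨y, u, v, β, hy, hβ, hyy, hν, hz, hSz, hu, hv⟩ := key S h hr hη ha hM hx hS
    have e : S.proj (x - x₀) = x - x₀ - S.1ᗮ.starProjection (x - x₀) := by
      rw [Submodule.starProjection_orthogonal']; simp [Grassmannian.proj]
    simp only [hy, hβ, e, hSz]
    have : x - x₀ - ((1 / 2 * β) • ν + v) - ((1 : ℝ) • y - β • ν) = u - v := by rw [hz]; module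
    rw [this]
    linarith [norm_nonneg u, norm_sub_le u v]
  · refine ⟨0, by norm_num, ?_⟩
    intro M x₀ x f b R C r η S h hr hη ha hM hx hS
    obtain ⟨y, u, v, β, hy, hβ, hyy, hν, hz, hSz, hu, hv⟩ := key S h hr hη ha hM hx hS
    simp only [hy, hβ, Grassmannian.projPerp, smul_apply, hSz]
    have : (-2 : ℝ) • ((1 / 2 * β) • ν + v) - ((0 : ℝ) • y - β • ν) = (-2 : ℝ) • v := by module
    rw [this, norm_smul]
    simp only [norm_neg, Real.norm_ofNat]
    linarith [norm_nonneg u]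
  · refine ⟨2, by norm_num, ?_⟩
    intro M x₀ x f b R C r η S h hr hη ha hM hx hS
    obtain ⟨y, u, v, β, hy, hβ, hyy, hν, hz, hSz, hu, hv⟩ := key S h hr hη ha hM hx hS
    simp only [hy, hβ, smul_apply, ContinuousLinearMap.id_apply]
    have : (2 : ℝ) • (x - x₀) - ((2 : ℝ) • y - β • ν) = (2 : ℝ) • u := by rw [hz]; module
    rw [this, norm_smul]
    simp only [Real.norm_ofNat]
    linarith [norm_nonneg u]
  · refine ⟨0, by norm_num, ?_⟩
    intro M x₀ x f b R C r η S h hr hη ha hM hx hS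
    obtain ⟨y, u, v, β, hy, hβ, hyy, hν, hz, hSz, hu, hv⟩ := key S h hr hη ha hM hx hS
    have e : S.proj (x - x₀) = x - x₀ - S.1ᗮ.starProjection (x - x₀) := by
      rw [Submodule.starProjection_orthogonal']; simp [Grassmannian.proj]
    simp only [hy, hβ, ContinuousLinearMap.comp_apply, e, hSz]
    have : (ℝ ∙ ν)ᗮᗮ.starProjection (x - x₀ - ((1 / 2 * β) • ν + v)) - ((0 : ℝ) • y - β • ν) =
        (ℝ ∙ ν)ᗮᗮ.starProjection (u - v) := by
      rw [hz]
      simp only [hN', map_sub, map_add, map_smul, hyy, hν]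
      module
    rw [this]
    linarith [norm_nonneg u, norm_sub_le u v, hN (u - v)]
  · refine ⟨0, by norm_num, ?_⟩
    intro M x₀ x f b R C r η S h hr hη ha hM hx hS
    obtain ⟨y, u, v, β, hy, hβ, hyy, hν, hz, hSz, hu, hv⟩ := key S h hr hη ha hM hx hS
    simp only [hy, hβ, ContinuousLinearMap.comp_apply, Grassmannian.projPerp, smul_apply, hSz]
    have : (-2 : ℝ) • (ℝ ∙ ν)ᗮᗮ.starProjection ((1 / 2 * β) • ν + v) - ((0 : ℝ) • y - β • ν) =
        (-2 : ℝ) • (ℝ ∙ ν)ᗮᗮ.starProjection v := by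
      simp only [hN', map_add, map_smul, hν]
      module
    rw [this, norm_smul]
    simp only [norm_neg, Real.norm_ofNat]
    linarith [norm_nonneg u, hN v]
  · refine ⟨0, by norm_num, ?_⟩
    intro M x₀ x f b R C r η S h hr hη ha hM hx hS
    obtain ⟨y, u, v, β, hy, hβ, hyy, hν, hz, hSz, hu, hv⟩ := key S h hr hη ha hM hx hS
    simp only [hy, hβ, smul_apply]
    have : (2 : ℝ) • (ℝ ∙ ν)ᗮᗮ.starProjection (x - x₀) - ((0 : ℝ) • y - β • ν) =
        (2 : ℝ) • (ℝ ∙ ν)ᗮᗮ.starProjection u := by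
      rw [hz]
      simp only [hN', map_sub, map_add, map_smul, hyy, hν]
      module
    rw [this, norm_smul]
    simp only [Real.norm_ofNat]
    linarith [norm_nonneg u, hN u]

theorem continuous_projectionChoice {d : ℕ} {N : Submodule ℝ (EuclideanSpace ℝ (Fin (d + 1)))}
    {P : EuclideanSpace ℝ (Fin (d + 1)) × Grassmannian d (d + 1) →
      (EuclideanSpace ℝ (Fin (d + 1)) →L[ℝ] EuclideanSpace ℝ (Fin (d + 1)))}
    (hP : P ∈ projectionChoices d N) : Continuous P := by
  have h1 : Continuous (Grassmannian.proj : Grassmannian d (d + 1) → _) :=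
    (show IsInducing (Grassmannian.proj : Grassmannian d (d + 1) → _) from ⟨rfl⟩).continuous
  have h2 : Continuous (Grassmannian.projPerp : Grassmannian d (d + 1) → _) := by
    have : (Grassmannian.projPerp : Grassmannian d (d + 1) → _) =
        fun S => ContinuousLinearMap.id ℝ _ - S.proj := by
      funext S
      exact Submodule.starProjection_orthogonal' _
    rw [this]
    fun_prop
  rcases hP with rfl | rfl | rfl | rfl | rfl | rfl <;> fun_prop

/-! ### Existence of normalised charts, and the mean curvature vector -/

theorem Varifold.IsHypersurface.exists_isNormalChart {d k : ℕ} {M : Set (EuclideanSpace ℝ (Fin (d + 1)))}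
    (hM : IsHypersurface d k M) (hk : 2 ≤ k) {x₀ : EuclideanSpace ℝ (Fin (d + 1))} (hx₀ : x₀ ∈ M) :
    ∃ (ν : EuclideanSpace ℝ (Fin (d + 1))) (f : EuclideanSpace ℝ (Fin (d + 1)) → ℝ) (R C : ℝ),
      IsNormalChart M x₀ ν f (fderiv ℝ (fderiv ℝ f) x₀) R C ∧ ContDiffAt ℝ k f x₀ ∧
      fderiv ℝ f x₀ = innerSL ℝ ν ∧
      ∀ x ∈ M, ‖x - x₀‖ < R → tangentSpace M x = (fderiv ℝ f x).ker := by
  obtain ⟨U, f₀, hU, hxU, hf₀, hf₀', hMU⟩ := hM x₀ hx₀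
  -- dividing by the length of the gradient at `x₀` normalises the equation
  set a := ‖fderiv ℝ f₀ x₀‖ with ha
  have ha0 : a ≠ 0 := norm_ne_zero_iff.2 (hf₀' x₀ hxU)
  let f : EuclideanSpace ℝ (Fin (d + 1)) → ℝ := fun x => a⁻¹ * f₀ x
  have hf : ContDiffOn ℝ k f U := contDiffOn_const.mul hf₀
  have hk1 : (1 : WithTop ℕ∞) ≤ k := by exact_mod_cast one_le_two.trans hk
  have hk2 : (2 : WithTop ℕ∞) ≤ k := by exact_mod_cast hk
  have hD : ∀ x ∈ U, fderiv ℝ f x = a⁻¹ • fderiv ℝ f₀ x := fun x hx =>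
    fderiv_const_mul ((hf₀.contDiffAt (hU.mem_nhds hx)).differentiableAt (by positivity)) _
  have hf' : ∀ x ∈ U, fderiv ℝ f x ≠ 0 := fun x hx => by
    rw [hD x hx]
    exact smul_ne_zero (inv_ne_zero ha0) (hf₀' x hx)
  have hMf : M ∩ U = {y ∈ U | f y = 0} := by
    rw [hMU]
    ext y
    simp [f, ha0]
  have hcd : ContDiffAt ℝ k f x₀ := hf.contDiffAt (hU.mem_nhds hxU)
  have hcd1 : ContDiffAt ℝ 1 (fderiv ℝ f) x₀ := hcd.fderiv_right (m := 1) (by rwa [one_add_one_eq_two])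
  obtain ⟨K, t, ht, hK⟩ := hcd1.exists_lipschitzOnWith
  obtain ⟨R₀, hR₀, hball⟩ := Metric.mem_nhds_iff.1 (inter_mem ht (hU.mem_nhds hxU))
  set b := fderiv ℝ (fderiv ℝ f) x₀ with hb
  set ν := (InnerProductSpace.toDual ℝ _).symm (fderiv ℝ f x₀) with hν
  have hνD : fderiv ℝ f x₀ = innerSL ℝ ν :=
    ((InnerProductSpace.toDual ℝ _).apply_symm_apply (fderiv ℝ f x₀)).symm
  have hC0 : 0 ≤ max (K : ℝ) ‖b‖ := le_max_of_le_left K.2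
  let R := min R₀ (1 / (4 * (max (K : ℝ) ‖b‖ + 1)))
  have hsub : ∀ x, ‖x - x₀‖ < R → x ∈ t ∩ U := fun x hx =>
    hball (by simpa [dist_eq_norm] using hx.trans_le (min_le_left _ _))
  have hx₀t : x₀ ∈ t := mem_of_mem_nhds ht
  refine ⟨ν, f, R, max (K : ℝ) ‖b‖, ⟨?_, by positivity, hC0, ?_, hx₀, ?_, ?_, ?_, ?_,
    le_max_right _ _⟩, hcd, hνD, ?_⟩
  · rw [hν, LinearIsometryEquiv.norm_map, hD x₀ hxU, norm_smul, norm_inv, ha, norm_norm]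
    exact inv_mul_cancel₀ ha0
  · calc _ ≤ max (K : ℝ) ‖b‖ * (1 / (4 * (max (K : ℝ) ‖b‖ + 1))) :=
          mul_le_mul_of_nonneg_left (min_le_right _ _) hC0
      _ ≤ 1 / 4 := by
          rw [mul_one_div, div_le_div_iff₀ (by positivity) (by norm_num)]
          linarith
  · intro x hx
    have := Set.ext_iff.1 hMf x
    simpa [(hsub x hx).2] using this
  · exact fun x hx => (hf.contDiffAt (hU.mem_nhds (hsub x hx).2)).differentiableAt (by positivity)
  · intro x hx
    rw [← hνD, ← dist_eq_norm, ← dist_eq_norm]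
    refine (hK.dist_le_mul x (hsub x hx).1 x₀ hx₀t).trans ?_
    gcongr
    exact le_max_left _ _
  · have := (hcd.of_le hk2).isSymmSndFDerivAt (by simp)
    exact fun v w => this.eq v w
  · exact fun x hx hxR => tangentSpace_eq_ker hx hU (hsub x hxR).2 (hf.of_le hk1)
      (hf' x (hsub x hxR).2) hMf

theorem tangentSpace_base_eq {d : ℕ} {M : Set (EuclideanSpace ℝ (Fin (d + 1)))}
    {x₀ ν : EuclideanSpace ℝ (Fin (d + 1))} {f : EuclideanSpace ℝ (Fin (d + 1)) → ℝ}
    (h₁ : fderiv ℝ f x₀ = innerSL ℝ ν) (h₂ : tangentSpace M x₀ = (fderiv ℝ f x₀).ker) :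
    tangentSpace M x₀ = (ℝ ∙ ν)ᗮ := by
  rw [h₂, h₁, ker_eq_orthogonal]
  congr
  exact (InnerProductSpace.toDual ℝ _).symm_apply_apply ν

section MeanCurvature

variable {d : ℕ} {M : Set (EuclideanSpace ℝ (Fin (d + 1)))}
  {x₀ ν : EuclideanSpace ℝ (Fin (d + 1))} {f : EuclideanSpace ℝ (Fin (d + 1)) → ℝ}
  {b : EuclideanSpace ℝ (Fin (d + 1)) →L[ℝ] EuclideanSpace ℝ (Fin (d + 1)) →L[ℝ] ℝ} {R C : ℝ}

theorem IsNormalChart.secondFundamentalForm_eq (h : IsNormalChart M x₀ ν f b R C)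
    (hf : HasFDerivAt (fderiv ℝ f) b x₀) (hν : fderiv ℝ f x₀ = innerSL ℝ ν)
    (hT : ∀ x ∈ M, ‖x - x₀‖ < R → tangentSpace M x = (fderiv ℝ f x).ker)
    {v w : EuclideanSpace ℝ (Fin (d + 1))} (hv : v ∈ tangentSpace M x₀)
    (hw : w ∈ tangentSpace M x₀) : secondFundamentalForm M x₀ v w = -b v w • ν := by
  have hT₀ := tangentSpace_base_eq hν (hT x₀ h.base_mem (by simpa using h.radius_pos))
  have hwν : inner ℝ ν w = 0 :=
    Submodule.mem_orthogonal_singleton_iff_inner_right.1 (hT₀ ▸ hw)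
  let J := (InnerProductSpace.toDual ℝ (EuclideanSpace ℝ (Fin (d + 1)))).symm
  let g : EuclideanSpace ℝ (Fin (d + 1)) → EuclideanSpace ℝ (Fin (d + 1)) :=
    fun y => J (fderiv ℝ f y)
  have hgν : g x₀ = ν := by
    simp only [g, hν]
    exact (InnerProductSpace.toDual ℝ _).symm_apply_apply ν
  have hgd : DifferentiableAt ℝ g x₀ :=
    J.toContinuousLinearEquiv.toContinuousLinearMap.differentiableAt.comp x₀ hf.differentiableAt
  let s : EuclideanSpace ℝ (Fin (d + 1)) → EuclideanSpace ℝ (Fin (d + 1)) :=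
    fun y => (‖g y‖ ^ 2)⁻¹ • g y
  have hsd : DifferentiableAt ℝ s x₀ :=
    ((hgd.norm_sq ℝ).inv (by rw [hgν, h.norm_normal]; norm_num)).smul hgd
  have hsν : s x₀ = ν := by simp [s, hgν, h.norm_normal]
  -- the factor `Df(y) w` vanishes at `x₀`, so only its derivative contributes
  have hW : HasFDerivAt (fun y => w - (fderiv ℝ f y w) • s y) (-(b.flip w).smulRight ν) x₀ := by
    have h1 : HasFDerivAt (fun y => fderiv ℝ f y w) (b.flip w) x₀ := by
      refine (hf.clm_apply (hasFDerivAt_const w x₀)).congr_fderiv ?_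
      ext v
      simp
    refine ((h1.smul hsd.hasFDerivAt).const_sub w).congr_fderiv ?_
    ext1 v
    simp [hν, hwν, hsν]
  have hW' : HasFDerivWithinAt (fun y => (tangentSpace M y).starProjection w)
      (-(b.flip w).smulRight ν) M x₀ := by
    have heq : ∀ y ∈ M, ‖y - x₀‖ < R →
        (tangentSpace M y).starProjection w = w - (fderiv ℝ f y w) • s y := fun y hy hyR => by
      have := starProjection_ker (fderiv ℝ f y) w
      simp only [hT y hy hyR, this, s, g, smul_smul, div_eq_mul_inv]
      rfl
    refine hW.hasFDerivWithinAt.congr_of_eventuallyEq ?_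
      (heq x₀ h.base_mem (by simpa using h.radius_pos))
    have hmem : Metric.ball x₀ R ∈ 𝓝[M] x₀ :=
      mem_nhdsWithin_of_mem_nhds (Metric.ball_mem_nhds x₀ h.radius_pos)
    filter_upwards [self_mem_nhdsWithin, hmem] with y hy hyR
    exact heq y hy (by simpa [dist_eq_norm] using hyR)
  have hval : fderivWithin ℝ (fun y => (tangentSpace M y).starProjection w) M x₀ v =
      (-(b.flip w).smulRight ν) v :=
    LinearMap.eqOn_span (f := (fderivWithin ℝ (fun y => (tangentSpace M y).starProjection w) M
        x₀).toLinearMap) (g := (-(b.flip w).smulRight ν).toLinearMap)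
      (hW'.differentiableWithinAt.hasFDerivWithinAt.unique_on hW') hv
  rw [secondFundamentalForm, hval]
  have hνT : ν ∈ (tangentSpace M x₀)ᗮ := by
    rw [hT₀]
    exact Submodule.le_orthogonal_orthogonal _ (Submodule.mem_span_singleton_self ν)
  have : (-(b.flip w).smulRight ν) v = -b v w • ν := by simp
  rw [this]
  exact Submodule.starProjection_eq_self_iff.2 (Submodule.smul_mem _ _ hνT)

theorem IsNormalChart.meanCurvatureVector_eq (h : IsNormalChart M x₀ ν f b R C)
    (hf : HasFDerivAt (fderiv ℝ f) b x₀) (hν : fderiv ℝ f x₀ = innerSL ℝ ν)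
    (hT : ∀ x ∈ M, ‖x - x₀‖ < R → tangentSpace M x = (fderiv ℝ f x).ker) :
    meanCurvatureVector M x₀ = ∑ i,
      -b (stdOrthonormalBasis ℝ (tangentSpace M x₀) i : EuclideanSpace ℝ (Fin (d + 1)))
        (stdOrthonormalBasis ℝ (tangentSpace M x₀) i : EuclideanSpace ℝ (Fin (d + 1))) • ν :=
  Finset.sum_congr rfl fun _ _ => h.secondFundamentalForm_eq hf hν hT (Subtype.mem _)
    (Subtype.mem _)

end MeanCurvature

section FDerivApprox

variable {E : Type*} [NormedAddCommGroup E] [InnerProductSpace ℝ E] {x₀ ν : E} {f : E → ℝ}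

theorem exists_fderivApprox (hν : fderiv ℝ f x₀ = innerSL ℝ ν) (hf : ContDiffAt ℝ 2 f x₀)
    {η : ℝ} (hη : 0 < η) :
    ∃ r₀ > 0, ∀ r < r₀, FDerivApprox x₀ ν f (fderiv ℝ (fderiv ℝ f) x₀) η r := by
  have hd : HasFDerivAt (fderiv ℝ f) (fderiv ℝ (fderiv ℝ f) x₀) x₀ :=
    ((hf.fderiv_right (m := 1) (by norm_num)).differentiableAt (by simp)).hasFDerivAt
  obtain ⟨r₀, hr₀, hball⟩ := Metric.eventually_nhds_iff.1 (hd.isLittleO.def hη)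
  refine ⟨r₀, hr₀, fun r hr x hx => ?_⟩
  have := hball (show dist x x₀ < r₀ by rw [dist_eq_norm]; exact hx.trans_lt hr)
  rw [← hν]
  exact this.trans (by gcongr)

theorem exists_fderivApprox_mul (hν : fderiv ℝ f x₀ = innerSL ℝ ν)
    (hf : ContDiffAt ℝ 3 f x₀) :
    ∃ K ≥ 0, ∃ r₀ > 0, ∀ r < r₀,
      FDerivApprox x₀ ν f (fderiv ℝ (fderiv ℝ f) x₀) (K * r) r := by
  have h2 : ContDiffAt ℝ 2 (fderiv ℝ f) x₀ := hf.fderiv_right (m := 2) (by norm_num)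
  have h1 : ContDiffAt ℝ 1 (fderiv ℝ (fderiv ℝ f)) x₀ := h2.fderiv_right (m := 1) (by norm_num)
  obtain ⟨K, t, ht, hK⟩ := h1.exists_lipschitzOnWith
  have hdiff : ∀ᶠ x in 𝓝 x₀, DifferentiableAt ℝ (fderiv ℝ f) x :=
    (h2.eventually (by simp)).mono fun x hx => hx.differentiableAt (by simp)
  obtain ⟨r₀, hr₀, hball⟩ := Metric.mem_nhds_iff.1 (inter_mem ht hdiff)
  refine ⟨K, K.2, r₀, hr₀, fun r hr x hx => ?_⟩
  have hin : ∀ y ∈ Metric.closedBall x₀ r, y ∈ t ∩ {x | DifferentiableAt ℝ (fderiv ℝ f) x} :=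
    fun y hy => hball (Metric.closedBall_subset_ball hr hy)
  have hr0 : 0 ≤ r := (norm_nonneg _).trans hx
  have := (convex_closedBall x₀ r).norm_image_sub_le_of_norm_fderiv_le' (𝕜 := ℝ) (f := fderiv ℝ f)
    (φ := fderiv ℝ (fderiv ℝ f) x₀) (C := K * r) (x := x₀) (y := x)
    (fun y hy => (hin y hy).2)
    (fun y hy => by
      rw [← dist_eq_norm]
      refine (hK.dist_le_mul y (hin y hy).1 x₀ (mem_of_mem_nhds ht)).trans ?_
      gcongr
      exact hy)
    (by simpa using hr0) (by simpa [dist_eq_norm] using hx)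
  rw [← hν]
  exact this.trans (by gcongr)

end FDerivApprox

/-! ### Integrals over the hypersurface near a point -/

theorem one_add_pow_le {u : ℝ} (h0 : 0 ≤ u) (h1 : u ≤ 1) (d : ℕ) : (1 + u) ^ d ≤ 1 + 3 ^ d * u := by
  induction d with
  | zero => simpa using h0
  | succ k ih =>
    have h3 : (1 : ℝ) ≤ 3 ^ k := one_le_pow₀ (by norm_num)
    calc (1 + u) ^ (k + 1) ≤ (1 + 3 ^ k * u) * (1 + u) := by rw [pow_succ]; gcongr
      _ ≤ 1 + 3 ^ (k + 1) * u := by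
          rw [pow_succ]
          nlinarith [mul_nonneg (by positivity : (0 : ℝ) ≤ 3 ^ k) h0,
            mul_le_mul_of_nonneg_left h1 (mul_nonneg (by positivity : (0 : ℝ) ≤ 3 ^ k) h0)]

theorem sum_stdOrthonormalBasis_congr {E G : Type*} [NormedAddCommGroup E] [InnerProductSpace ℝ E]
    [FiniteDimensional ℝ E] [AddCommMonoid G] {S T : Submodule ℝ E} (h : S = T) (F : E → G) :
    ∑ i, F (stdOrthonormalBasis ℝ S i : E) = ∑ i, F (stdOrthonormalBasis ℝ T i : E) := by
  subst h
  rfl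

section Local

variable {d : ℕ} {M : Set (EuclideanSpace ℝ (Fin (d + 1)))}
  {x₀ ν : EuclideanSpace ℝ (Fin (d + 1))} {f : EuclideanSpace ℝ (Fin (d + 1)) → ℝ}
  {b : EuclideanSpace ℝ (Fin (d + 1)) →L[ℝ] EuclideanSpace ℝ (Fin (d + 1)) →L[ℝ] ℝ}
  {R C ε η A : ℝ} {ρ ξ : ℝ → ℝ}

theorem IsNormalChart.finrank_orthogonal (h : IsNormalChart M x₀ ν f b R C) :
    Module.finrank ℝ (ℝ ∙ ν)ᗮ = d := by
  have : Fact (Module.finrank ℝ (EuclideanSpace ℝ (Fin (d + 1))) = d + 1) := ⟨by simp⟩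
  refine Submodule.finrank_orthogonal_span_singleton fun h0 => ?_
  have := h.norm_normal
  rw [h0, norm_zero] at this
  exact zero_ne_one this

/-- Comparison of an integral over `M` with an integral over the tangent plane, for an integrand
supported in the ball of radius `ε` around `x₀`. The measure of `M` projects onto a measure which is
`1 + O(ε²)` times Lebesgue measure. -/
theorem IsNormalChart.integrable_and_norm_integral_sub_le {G : Type*} [NormedAddCommGroup G]
    [NormedSpace ℝ G] (h : IsNormalChart M x₀ ν f b R C) (hM : MeasurableSet M) (hε : 0 < ε)
    (hεR : 2 * ε < R) {K δ : ℝ} (hδ : 0 ≤ δ) {F : M → G} (hF : StronglyMeasurable F)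
    (hF0 : ∀ x : M, ε ≤ ‖x.1 - x₀‖ → F x = 0) {F₀ : (ℝ ∙ ν)ᗮ → G} (hF₀ : StronglyMeasurable F₀)
    (hF₀0 : ∀ y, ε ≤ ‖y‖ → F₀ y = 0) (hK : ∀ y, ‖F₀ y‖ ≤ K)
    (hFF₀ : ∀ x : M, ‖x.1 - x₀‖ < R → ‖x.1 - x₀‖ ≤ 2 * ε →
      ‖(ℝ ∙ ν)ᗮ.orthogonalProjectionOnto (x.1 - x₀)‖ < ε →
      ‖F x - F₀ ((ℝ ∙ ν)ᗮ.orthogonalProjectionOnto (x.1 - x₀))‖ ≤ δ) :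
    Integrable F (Measure.comap Subtype.val μHE[d]) ∧
      ‖∫ x, F x ∂(Measure.comap Subtype.val μHE[d]) - ∫ y, F₀ y‖ ≤
        (δ * (1 + 3 ^ d) + K * (3 ^ d * (4 * C ^ 2 * ε ^ 2))) *
          (ε ^ d * (volume : Measure (ℝ ∙ ν)ᗮ).real (Metric.ball 0 1)) := by
  rw [comap_subtype_val_euclideanHausdorffMeasure hM]
  let p : M → (ℝ ∙ ν)ᗮ := fun x => (ℝ ∙ ν)ᗮ.orthogonalProjectionOnto (x.1 - x₀)
  have hpc : Continuous p := by fun_prop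
  have hps : ∀ x : M, ((p x : (ℝ ∙ ν)ᗮ) : EuclideanSpace ℝ (Fin (d + 1))) =
      (ℝ ∙ ν)ᗮ.starProjection (x.1 - x₀) := fun x => rfl
  have hpd : ∀ x y : M, dist (p x) (p y) = ‖(ℝ ∙ ν)ᗮ.starProjection (x.1 - y.1)‖ := fun x y => by
    rw [dist_eq_norm]
    change ‖((p x - p y : (ℝ ∙ ν)ᗮ) : EuclideanSpace ℝ (Fin (d + 1)))‖ = _
    rw [Submodule.coe_sub, hps, hps, ← map_sub, sub_sub_sub_cancel_right]
  have hp1 : LipschitzWith 1 p := LipschitzWith.of_dist_le_mul fun x y => by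
    rw [hpd, NNReal.coe_one, one_mul, Subtype.dist_eq, dist_eq_norm]
    exact Submodule.norm_starProjection_apply_le _ _
  let S : Set M := {x | ‖x.1 - x₀‖ < R ∧ ‖p x‖ < ε}
  have hS : MeasurableSet S := by
    refine MeasurableSet.inter ?_ ?_
    · exact (isOpen_lt (f := fun x : M => ‖x.1 - x₀‖) (by fun_prop) continuous_const).measurableSet
    · exact (isOpen_lt hpc.norm continuous_const).measurableSet
  have hS2 : ∀ x ∈ S, ‖x.1 - x₀‖ ≤ 2 * ε := fun x hx =>
    (h.norm_le_two_mul x.2 hx.1).trans (mul_le_mul_of_nonneg_left hx.2.le zero_le_two)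
  have himg : p '' S = Metric.ball 0 ε := by
    ext y
    rw [mem_ball_zero_iff]
    constructor
    · rintro ⟨x, hx, rfl⟩
      exact hx.2
    · intro hy
      obtain ⟨x, hxM, hxR, hxy⟩ := h.exists_mem_of_starProjection y.2
        (lt_trans (mul_lt_mul_of_pos_left hy zero_lt_two) hεR)
      have : p ⟨x, hxM⟩ = y := Subtype.ext hxy
      exact ⟨⟨x, hxM⟩, ⟨hxR, by rw [this]; exact hy⟩, this⟩
  have hC := h.const_nonneg
  let Λ : NNReal := ⟨1 + C ^ 2 * (2 * ε) ^ 2, by positivity⟩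
  have hanti : ∀ x ∈ S, ∀ y ∈ S, dist x y ≤ Λ * dist (p x) (p y) := fun x hx y hy => by
    rw [hpd, Subtype.dist_eq, dist_eq_norm]
    exact h.norm_sub_le_starProjection hεR (by positivity) x.2 (hS2 x hx) y.2 (hS2 y hy)
  have hsand := volume_restrict_le_map_and_map_le h.finrank_orthogonal hp1 himg hanti
  have hu : C ^ 2 * (2 * ε) ^ 2 ≤ 1 := by
    have h1 : C * (2 * ε) ≤ 1 / 4 := (mul_le_mul_of_nonneg_left hεR.le hC).trans h.radius_small
    rw [← mul_pow]
    exact pow_le_one₀ (by positivity) (by linarith)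
  set κ := 3 ^ d * (C ^ 2 * (2 * ε) ^ 2) with hκ
  have hκ0 : 0 ≤ κ := by positivity
  have hup : (μHE[d].restrict S).map p ≤
      ENNReal.ofReal (1 + κ) • volume.restrict (Metric.ball (0 : (ℝ ∙ ν)ᗮ) ε) := by
    refine hsand.2.trans (Measure.le_iff.2 fun s _ => ?_)
    rw [Measure.smul_apply, Measure.smul_apply, smul_eq_mul, smul_eq_mul]
    gcongr
    rw [← ENNReal.coe_pow, ← ENNReal.ofReal_coe_nnreal]
    refine ENNReal.ofReal_le_ofReal ?_
    rw [NNReal.coe_pow]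
    exact one_add_pow_le (by positivity) hu d
  have hfin : IsFiniteMeasure (volume.restrict (Metric.ball (0 : (ℝ ∙ ν)ᗮ) ε)) :=
    ⟨by simpa using measure_ball_lt_top⟩
  have main := _root_.integrable_and_norm_integral_sub_le hpc.measurable hS hκ0 hδ hsand.1 hup hF
    (fun x hx => hF0 x (by
      by_contra! hlt
      refine hx ⟨by linarith, ?_⟩
      exact (Submodule.norm_starProjection_apply_le _ _).trans_lt hlt)) hF₀ hK
    (fun x hx => hFF₀ x hx.1 (hS2 x hx) hx.2)
  refine ⟨main.1, ?_⟩
  have hball : ∫ y in Metric.ball 0 ε, F₀ y = ∫ y, F₀ y :=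
    setIntegral_eq_integral_of_forall_compl_eq_zero fun y hy => hF₀0 y (by simpa using hy)
  have hvol : (volume.restrict (Metric.ball (0 : (ℝ ∙ ν)ᗮ) ε)).real univ =
      ε ^ d * (volume : Measure (ℝ ∙ ν)ᗮ).real (Metric.ball 0 1) := by
    rw [measureReal_restrict_apply_univ, measureReal_def, measureReal_def,
      Measure.addHaar_ball_of_pos _ _ hε, h.finrank_orthogonal, ENNReal.toReal_mul,
      ENNReal.toReal_ofReal (by positivity)]
  have h2 := main.2
  rw [hball, hvol] at h2
  refine h2.trans ?_
  have hκ1 : κ ≤ 3 ^ d := mul_le_of_le_one_right (by positivity) hu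
  have hκ2 : κ = 3 ^ d * (4 * C ^ 2 * ε ^ 2) := by rw [hκ]; ring
  rw [← hκ2]
  gcongr

theorem integrable_comp_norm_div {T : Type*} [NormedAddCommGroup T] [InnerProductSpace ℝ T]
    [FiniteDimensional ℝ T] [MeasurableSpace T] [BorelSpace T] (hξ : Continuous ξ) (hε : 0 < ε)
    {n : ℕ} (hA : KernelBounds n ρ ξ A) : Integrable fun y : T => ξ (‖y‖ / ε) := by
  refine Continuous.integrable_of_hasCompactSupport (by fun_prop)
    (HasCompactSupport.intro (isCompact_closedBall (0 : T) ε) fun y hy => hA.xi_comp_div_eq_zero hε ?_)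
  simpa using (not_le.1 (by simpa using hy)).le

theorem IsNormalChart.mass_estimate (h : IsNormalChart M x₀ ν f b R C) (hM : MeasurableSet M)
    (hε : 0 < ε) (hεR : 2 * ε < R) {n : ℕ} (hξ : Continuous ξ) (hA : KernelBounds n ρ ξ A) :
    Integrable (fun x : M => massIntegrand ξ ε x₀ x) (Measure.comap Subtype.val μHE[d]) ∧
      |∫ x : M, massIntegrand ξ ε x₀ x ∂(Measure.comap Subtype.val μHE[d]) -
        ε ^ d * ∫ y : (ℝ ∙ ν)ᗮ, ξ ‖y‖| ≤
        (16 * A * C ^ 2 * ε ^ 2 * (1 + 3 ^ d) + A * (3 ^ d * (4 * C ^ 2 * ε ^ 2))) *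
          (ε ^ d * (volume : Measure (ℝ ∙ ν)ᗮ).real (Metric.ball 0 1)) := by
  have hA0 := hA.nonneg
  have key := h.integrable_and_norm_integral_sub_le hM hε hεR (K := A)
    (δ := 16 * A * C ^ 2 * ε ^ 2) (by positivity)
    (F := fun x : M => massIntegrand ξ ε x₀ x) (F₀ := fun y => ξ (‖y‖ / ε))
    (by unfold massIntegrand; exact Continuous.stronglyMeasurable (by fun_prop))
    (fun x hx => hA.xi_comp_div_eq_zero hε hx) (Continuous.stronglyMeasurable (by fun_prop))
    (fun y hy => hA.xi_comp_div_eq_zero hε hy) (fun y => hA.xi_bound _) (fun x hxR _ hy => by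
      have h1 := hA.xi_lip (‖x.1 - x₀‖ / ε)
        (‖(ℝ ∙ ν)ᗮ.orthogonalProjectionOnto (x.1 - x₀)‖ / ε)
      have h2 := h.abs_norm_sub_norm_starProjection_le x.2 hxR
      have h3 : ‖(ℝ ∙ ν)ᗮ.starProjection (x.1 - x₀)‖ ≤ ε := hy.le
      rw [← sub_div, abs_div, abs_of_pos hε] at h1
      refine h1.trans ?_
      calc _ ≤ A * (16 * C ^ 2 * ‖(ℝ ∙ ν)ᗮ.starProjection (x.1 - x₀)‖ ^ 3 / ε) := by
            gcongr
            exact h2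
        _ ≤ A * (16 * C ^ 2 * ε ^ 3 / ε) := by gcongr
        _ = _ := by field_simp)
  rw [integral_comp_norm_div ξ hε, h.finrank_orthogonal] at key
  exact key

/-- The integral over the tangent plane of the leading part of the regularised first variation. The
linear part integrates to `0` by symmetry; the quadratic one gives the trace of the second
fundamental form. -/
theorem IsNormalChart.integral_model (h : IsNormalChart M x₀ ν f b R C) (hd : 1 ≤ d) (hε : 0 < ε)
    {n : ℕ} (hξ : Continuous ξ) (hA : KernelBounds n ρ ξ A) (l : ℝ) :
    ∫ y : (ℝ ∙ ν)ᗮ, (deriv ρ (‖y‖ / ε) / ‖y‖) •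
        (l • (y : EuclideanSpace ℝ (Fin (d + 1))) - b y y • ν) =
      (-(n / d * (ε ^ (d + 1) * ∫ y : (ℝ ∙ ν)ᗮ, ξ ‖y‖))) •
        ∑ i, -b (stdOrthonormalBasis ℝ (ℝ ∙ ν)ᗮ i : EuclideanSpace ℝ (Fin (d + 1)))
          (stdOrthonormalBasis ℝ (ℝ ∙ ν)ᗮ i : EuclideanSpace ℝ (Fin (d + 1))) • ν := by
  let φ : ℝ → ℝ := fun t => deriv ρ (t / ε) / t
  have hφm : Measurable φ := ((measurable_deriv ρ).comp (measurable_id.div_const ε)).div measurable_id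
  have hsq : ∀ y : (ℝ ∙ ν)ᗮ, φ ‖y‖ * ‖y‖ ^ 2 = -(n * ε) * ξ (‖y‖ / ε) := fun y =>
    hA.div_mul_sq hε (norm_nonneg y)
  have hsqi : Integrable fun y : (ℝ ∙ ν)ᗮ => φ ‖y‖ * ‖y‖ ^ 2 := by
    simp_rw [hsq]
    exact (integrable_comp_norm_div hξ hε hA).const_mul _
  let B : (ℝ ∙ ν)ᗮ →ₗ[ℝ] (ℝ ∙ ν)ᗮ →ₗ[ℝ] EuclideanSpace ℝ (Fin (d + 1)) :=
    LinearMap.mk₂ ℝ (fun v w => -b v w • ν)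
      (fun v v' w => by simp [add_smul]; abel) (fun c v w => by simp [smul_smul])
      (fun v w w' => by simp [add_smul]; abel) (fun c v w => by simp [smul_smul])
  have hBv : ∀ v w, B v w = -b v w • ν := fun v w => rfl
  have hquad := integral_radial_smul_quadratic φ (stdOrthonormalBasis ℝ (ℝ ∙ ν)ᗮ) hsqi hφm B
  have hlin := integral_radial_smul_self φ (l • (ℝ ∙ ν)ᗮ.subtype)
  have hBi : Integrable fun y : (ℝ ∙ ν)ᗮ => φ ‖y‖ • B y y := by
    have hbc : Continuous fun y : (ℝ ∙ ν)ᗮ => B y y := by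
      simp only [hBv]
      fun_prop
    refine (hsqi.norm.const_mul C).mono' ((hφm.comp measurable_norm).aestronglyMeasurable.smul
      hbc.aestronglyMeasurable) (Eventually.of_forall fun y => ?_)
    rw [norm_smul, hBv, norm_smul, h.norm_normal, mul_one, norm_neg, norm_mul, norm_pow, norm_norm,
      mul_left_comm]
    gcongr
    refine (b.le_opNorm₂ _ _).trans ?_
    rw [mul_assoc, sq]
    exact mul_le_mul_of_nonneg_right h.norm_hess_le (by positivity)
  have hLi : Integrable fun y : (ℝ ∙ ν)ᗮ => φ ‖y‖ • (l • (ℝ ∙ ν)ᗮ.subtype) y := by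
    have hbd : ∀ y : (ℝ ∙ ν)ᗮ, ‖φ ‖y‖ • (l • (ℝ ∙ ν)ᗮ.subtype) y‖ ≤ A / ε * (|l| * ε) := fun y => by
      rcases le_or_gt ε ‖y‖ with hy | hy
      · simp only [φ, hA.deriv_comp_div_eq_zero hε hy, zero_div, zero_smul, norm_zero]
        have := hA.nonneg
        positivity
      · rw [norm_smul]
        refine mul_le_mul (hA.abs_div_le hε _) ?_ (norm_nonneg _) (div_nonneg hA.nonneg hε.le)
        simp only [LinearMap.smul_apply, norm_smul, Real.norm_eq_abs]
        gcongr
        exact hy.le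
    have hmeas : AEStronglyMeasurable (fun y : (ℝ ∙ ν)ᗮ => φ ‖y‖ • (l • (ℝ ∙ ν)ᗮ.subtype) y) :=
      (hφm.comp measurable_norm).aestronglyMeasurable.smul
        (show Continuous fun y : (ℝ ∙ ν)ᗮ => l • (y : EuclideanSpace ℝ (Fin (d + 1))) by
          fun_prop).aestronglyMeasurable
    refine (integrableOn_iff_integrable_of_support_subset (s := Metric.closedBall 0 ε) ?_).1
      (Measure.integrableOn_of_bounded (M := A / ε * (|l| * ε)) measure_closedBall_lt_top.ne hmeas
        (Eventually.of_forall hbd))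
    intro y hy
    by_contra hy'
    refine hy ?_
    have : ε ≤ ‖y‖ := (not_le.1 (by simpa using hy')).le
    simp only [φ, hA.deriv_comp_div_eq_zero hε this, zero_div, zero_smul]
  have hd0 : (d : ℝ) ≠ 0 := by positivity
  have hsplit : ∀ y : (ℝ ∙ ν)ᗮ, (deriv ρ (‖y‖ / ε) / ‖y‖) •
      (l • (y : EuclideanSpace ℝ (Fin (d + 1))) - b y y • ν) =
      φ ‖y‖ • (l • (ℝ ∙ ν)ᗮ.subtype) y + φ ‖y‖ • B y y := fun y => by
    rw [hBv, ← smul_add, neg_smul, ← sub_eq_add_neg]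
    rfl
  simp_rw [hsplit]
  rw [integral_add hLi hBi, hlin, zero_add]
  simp_rw [hsq] at hquad
  have hmass : ∫ y : (ℝ ∙ ν)ᗮ, ξ (‖y‖ / ε) = ε ^ d * ∫ y : (ℝ ∙ ν)ᗮ, ξ ‖y‖ := by
    rw [integral_comp_norm_div ξ hε, h.finrank_orthogonal]
  have hcard : (Fintype.card (Fin (Module.finrank ℝ (ℝ ∙ ν)ᗮ)) : ℝ) = d := by
    rw [Fintype.card_fin, h.finrank_orthogonal]
  rw [integral_const_mul, hmass, hcard] at hquad
  rw [← inv_smul_smul₀ hd0 (∫ y : (ℝ ∙ ν)ᗮ, φ ‖y‖ • B y y), hquad, smul_smul]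
  congr 1
  field_simp
  ring

end Local

/-! ### Convergence of the regularised mean curvature -/

section Assembly

variable {d : ℕ} {M : Set (EuclideanSpace ℝ (Fin (d + 1)))}
  {x₀ ν : EuclideanSpace ℝ (Fin (d + 1))} {f : EuclideanSpace ℝ (Fin (d + 1)) → ℝ}
  {b : EuclideanSpace ℝ (Fin (d + 1)) →L[ℝ] EuclideanSpace ℝ (Fin (d + 1)) →L[ℝ] ℝ}
  {R C ε η A : ℝ} {ρ ξ : ℝ → ℝ}
  {P : EuclideanSpace ℝ (Fin (d + 1)) × Grassmannian d (d + 1) →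
    (EuclideanSpace ℝ (Fin (d + 1)) →L[ℝ] EuclideanSpace ℝ (Fin (d + 1)))}

theorem measurable_variationIntegrand (hP : Continuous P) :
    Measurable (variationIntegrand ρ P ε x₀) := by
  have h1 : Measurable fun p : EuclideanSpace ℝ (Fin (d + 1)) × Grassmannian d (d + 1) =>
      ‖p.1 - x₀‖ := (by fun_prop : Continuous _).measurable
  have h2 : Measurable fun p : EuclideanSpace ℝ (Fin (d + 1)) × Grassmannian d (d + 1) =>
      P p (p.1 - x₀) := (hP.clm_apply (by fun_prop)).measurable
  exact (((measurable_deriv ρ).comp (h1.div_const ε)).div h1).smul h2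

/-- The regularised first variation equals its tangent-plane model, a multiple of the trace of the
second fundamental form, up to `O(ε ^ (d + 1) (η + ε))`. -/
theorem IsNormalChart.variation_estimate (h : IsNormalChart M x₀ ν f b R C)
    (hM : IsHypersurface d 1 M) (hd : 1 ≤ d)
    (hT : ∀ x ∈ M, ‖x - x₀‖ < R → tangentSpace M x = (fderiv ℝ f x).ker)
    (hε : 0 < ε) (hεR : 2 * ε < R) (hε1 : ε ≤ 1) {n : ℕ} (hξ : Continuous ξ)
    (hA : KernelBounds n ρ ξ A) (hP : P ∈ projectionChoices d (ℝ ∙ ν)ᗮᗮ) (hη : 0 ≤ η)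
    (ha : FDerivApprox x₀ ν f b η (2 * ε)) :
    Integrable (fun x : M => variationIntegrand ρ P ε x₀ (x, tangentPlane hM x))
        (Measure.comap Subtype.val μHE[d]) ∧
      ‖∫ x : M, variationIntegrand ρ P ε x₀ (x, tangentPlane hM x)
          ∂(Measure.comap Subtype.val μHE[d]) -
        (-(n / d * (ε ^ (d + 1) * ∫ y : (ℝ ∙ ν)ᗮ, ξ ‖y‖))) •
        ∑ i, -b (stdOrthonormalBasis ℝ (ℝ ∙ ν)ᗮ i : EuclideanSpace ℝ (Fin (d + 1)))
          (stdOrthonormalBasis ℝ (ℝ ∙ ν)ᗮ i : EuclideanSpace ℝ (Fin (d + 1))) • ν‖ ≤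
        A * ((40 + 80 * C ^ 2 + 32 * C ^ 2 * (2 + C)) * (1 + 3 ^ d) +
          (2 + C) * (3 ^ d * (4 * C ^ 2))) *
          (volume : Measure (ℝ ∙ ν)ᗮ).real (Metric.ball 0 1) * (ε ^ (d + 1) * (η + ε)) := by
  have hA0 := hA.nonneg
  have hC := h.const_nonneg
  obtain ⟨l, hl, hexp⟩ := exists_norm_projectionChoice_sub_le hP
  have hΦ : Continuous fun x : M => (x.1, tangentPlane hM x) :=
    continuous_subtype_val.prodMk (continuous_tangentPlane hM)
  have hbil : ∀ y : (ℝ ∙ ν)ᗮ, ‖y‖ ≤ 1 →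
      ‖l • (y : EuclideanSpace ℝ (Fin (d + 1))) - b y y • ν‖ ≤ (2 + C) * ‖y‖ := fun y hy => by
    have h1 : |b y y| ≤ C * ‖y‖ * ‖y‖ :=
      (b.le_opNorm₂ _ _).trans (mul_le_mul_of_nonneg_right
        (mul_le_mul_of_nonneg_right h.norm_hess_le (norm_nonneg _)) (norm_nonneg _))
    have h2 : C * ‖y‖ * ‖y‖ ≤ C * ‖y‖ := mul_le_of_le_one_right (by positivity) hy
    refine (norm_sub_le _ _).trans ?_
    rw [norm_smul, norm_smul, h.norm_normal, mul_one, Real.norm_eq_abs, Real.norm_eq_abs, add_mul]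
    have h3 : |l| * ‖y‖ ≤ 2 * ‖y‖ := by gcongr
    exact add_le_add h3 (h1.trans h2)
  have hk := fun t => hA.abs_div_le hε t
  have key := h.integrable_and_norm_integral_sub_le hM.measurableSet hε hεR (K := A * (2 + C))
    (δ := A * (40 + 80 * C ^ 2 + 32 * C ^ 2 * (2 + C)) * (ε * (η + ε))) (by positivity)
    (F := fun x : M => variationIntegrand ρ P ε x₀ (x, tangentPlane hM x))
    (F₀ := fun y => (deriv ρ (‖y‖ / ε) / ‖y‖) •
        (l • (y : EuclideanSpace ℝ (Fin (d + 1))) - b y y • ν))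
    ((measurable_variationIntegrand (continuous_projectionChoice hP)).comp
      hΦ.measurable).stronglyMeasurable
    (fun x hx => by simp only [variationIntegrand, hA.deriv_comp_div_eq_zero hε hx, zero_div, zero_smul])
    (((((measurable_deriv ρ).comp (measurable_norm.div_const ε)).div
      measurable_norm).stronglyMeasurable).smul
      (Continuous.stronglyMeasurable (by fun_prop)))
    (fun y hy => by simp only [hA.deriv_comp_div_eq_zero hε hy, zero_div, zero_smul])
    (fun y => by
      rcases le_or_gt ε ‖y‖ with hy | hy
      · simp only [hA.deriv_comp_div_eq_zero hε hy, zero_div, zero_smul, norm_zero]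
        positivity
      · rw [norm_smul]
        calc _ ≤ A / ε * ((2 + C) * ε) := by
              refine mul_le_mul (hk _) ((hbil y (hy.le.trans hε1)).trans ?_) (norm_nonneg _)
                (by positivity)
              gcongr
          _ = A * (2 + C) := by field_simp)
    (fun x hxR hx2 hy => by
      set y := (ℝ ∙ ν)ᗮ.orthogonalProjectionOnto (x.1 - x₀) with hydef
      have h1 := hexp (tangentPlane hM x) h hεR hη ha x.2 hx2 (hT x x.2 hxR)
      have h2 := h.abs_norm_sub_norm_starProjection_le x.2 hxR
      have h3 := hA.abs_div_sub_div_mul_le hε ‖x.1 - x₀‖ (norm_nonneg y)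
      have hys : (ℝ ∙ ν)ᗮ.starProjection (x.1 - x₀) = y := rfl
      rw [hys] at h1 h2
      have hyn : ‖(y : EuclideanSpace ℝ (Fin (d + 1)))‖ = ‖y‖ := rfl
      rw [hyn] at h2
      set w := l • (y : EuclideanSpace ℝ (Fin (d + 1))) - b y y • ν with hw
      have hbw := hbil y (hy.le.trans hε1)
      rw [← hw] at hbw
      change ‖variationIntegrand ρ P ε x₀ (x.1, tangentPlane hM x) -
        (deriv ρ (‖y‖ / ε) / ‖y‖) • w‖ ≤ _
      clear_value w
      have e : variationIntegrand ρ P ε x₀ (x.1, tangentPlane hM x) -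
          (deriv ρ (‖y‖ / ε) / ‖y‖) • w =
          (deriv ρ (‖x.1 - x₀‖ / ε) / ‖x.1 - x₀‖) • (P (x.1, tangentPlane hM x) (x.1 - x₀) - w) +
          (deriv ρ (‖x.1 - x₀‖ / ε) / ‖x.1 - x₀‖ - deriv ρ (‖y‖ / ε) / ‖y‖) • w := by
        rw [smul_sub, sub_smul, variationIntegrand]
        abel
      rw [e]
      have h4 : ‖(deriv ρ (‖x.1 - x₀‖ / ε) / ‖x.1 - x₀‖) •
          (P (x.1, tangentPlane hM x) (x.1 - x₀) - w)‖ ≤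
          A / ε * (10 * (η * (2 * ε) ^ 2 + C ^ 2 * (2 * ε) ^ 3)) := by
        rw [norm_smul]
        exact mul_le_mul (hk _) h1 (norm_nonneg _) (by positivity)
      have h5 : ‖(deriv ρ (‖x.1 - x₀‖ / ε) / ‖x.1 - x₀‖ - deriv ρ (‖y‖ / ε) / ‖y‖) • w‖ ≤
          2 * A / ε * (16 * C ^ 2 * ε ^ 3) * (2 + C) := by
        rw [norm_smul, Real.norm_eq_abs]
        calc _ ≤ |deriv ρ (‖x.1 - x₀‖ / ε) / ‖x.1 - x₀‖ - deriv ρ (‖y‖ / ε) / ‖y‖| *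
              ((2 + C) * ‖y‖) := by gcongr
          _ = |deriv ρ (‖x.1 - x₀‖ / ε) / ‖x.1 - x₀‖ - deriv ρ (‖y‖ / ε) / ‖y‖| * ‖y‖ *
              (2 + C) := by ring
          _ ≤ _ := by
              refine mul_le_mul_of_nonneg_right (h3.trans ?_) (by positivity)
              gcongr
              exact h2.trans (by gcongr)
      refine (norm_add_le _ _).trans ((add_le_add h4 h5).trans ?_)
      have e4 : A / ε * (10 * (η * (2 * ε) ^ 2 + C ^ 2 * (2 * ε) ^ 3)) =
          A * (40 * (ε * η) + 80 * C ^ 2 * ε ^ 2) := by field_simp; ring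
      have e5 : 2 * A / ε * (16 * C ^ 2 * ε ^ 3) * (2 + C) =
          A * (32 * C ^ 2 * (2 + C) * ε ^ 2) := by field_simp; ring
      rw [e4, e5, ← mul_add, mul_assoc A]
      refine mul_le_mul_of_nonneg_left ?_ hA0
      have h6 : 0 ≤ (80 * C ^ 2 + 32 * C ^ 2 * (2 + C)) * (ε * η) := by positivity
      nlinarith [sq_nonneg ε])
  rw [h.integral_model hd hε hξ hA l] at key
  refine ⟨key.1, key.2.trans ?_⟩
  have e : A * ((40 + 80 * C ^ 2 + 32 * C ^ 2 * (2 + C)) * (1 + 3 ^ d) +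
          (2 + C) * (3 ^ d * (4 * C ^ 2))) *
          (volume : Measure (ℝ ∙ ν)ᗮ).real (Metric.ball 0 1) * (ε ^ (d + 1) * (η + ε)) =
      (A * (40 + 80 * C ^ 2 + 32 * C ^ 2 * (2 + C)) * (ε * (η + ε)) * (1 + 3 ^ d) +
        A * (2 + C) * (3 ^ d * (4 * C ^ 2 * (ε * (η + ε))))) *
        (ε ^ d * (volume : Measure (ℝ ∙ ν)ᗮ).real (Metric.ball 0 1)) := by ring
  rw [e]
  gcongr
  nlinarith [mul_nonneg hε.le hη]

/-- The error of a quotient whose numerator and denominator are known to relative accuracy. -/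
theorem norm_quotient_sub_le {G : Type*} [NormedAddCommGroup G] [NormedSpace ℝ G] {N H : G}
    {D c K₁ K₂ : ℝ} {d n : ℕ} (hd : 1 ≤ d) (hdn : d ≤ n) (hε : 0 < ε) (hc : 0 < c)
    (hη : 0 ≤ η)
    (hN : ‖N - (-((n : ℝ) / d * (ε ^ (d + 1) * c))) • H‖ ≤ K₂ * (ε ^ (d + 1) * (η + ε)))
    (hD : |D - ε ^ d * c| ≤ K₁ * ε ^ (d + 1)) (hsmall : K₁ * ε ≤ c / 2) :
    0 < D ∧ ‖(-((d : ℝ) / (n * ε)) / D) • N - H‖ ≤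
      (2 * K₂ / c + 2 * K₁ / c * ‖H‖) * (η + ε) := by
  have hd0 : (0 : ℝ) < d := by exact_mod_cast hd
  have hn0 : (0 : ℝ) < n := by exact_mod_cast hd.trans hdn
  have hpow : 0 < ε ^ d := pow_pos hε d
  have hDc : ε ^ d * (c / 2) ≤ D := by
    have h1 : K₁ * ε ^ (d + 1) ≤ ε ^ d * (c / 2) := by
      rw [pow_succ, mul_comm (ε ^ d) ε, ← mul_assoc, mul_comm (ε ^ d)]
      gcongr
    linarith [(abs_le.1 hD).1]
  have hDpos : 0 < D := lt_of_lt_of_le (by positivity) hDc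
  have hK₁ : 0 ≤ K₁ := by
    have := (abs_nonneg _).trans hD
    exact nonneg_of_mul_nonneg_left this (by positivity)
  refine ⟨hDpos, ?_⟩
  have e : (-((d : ℝ) / (n * ε)) / D) • N - H =
      (-((d : ℝ) / (n * ε)) / D) • (N - (-((n : ℝ) / d * (ε ^ (d + 1) * c))) • H) +
        ((ε ^ d * c - D) / D) • H := by
    have : (-((d : ℝ) / (n * ε)) / D) * (-((n : ℝ) / d * (ε ^ (d + 1) * c))) =
        1 + (ε ^ d * c - D) / D := by
      field_simp
      ring
    rw [smul_sub, smul_smul, this, add_smul, one_smul]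
    abel
  rw [e]
  have h1 : ‖(-((d : ℝ) / (n * ε)) / D) • (N - (-((n : ℝ) / d * (ε ^ (d + 1) * c))) • H)‖ ≤
      2 * K₂ / c * (η + ε) := by
    rw [norm_smul, Real.norm_eq_abs, abs_div, abs_neg, abs_of_pos hDpos,
      abs_of_pos (by positivity : (0 : ℝ) < d / (n * ε))]
    calc _ ≤ 1 / ε / (ε ^ d * (c / 2)) * (K₂ * (ε ^ (d + 1) * (η + ε))) := by
          have : (d : ℝ) / (n * ε) ≤ 1 / ε := by
            rw [div_le_div_iff₀ (by positivity) hε, one_mul]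
            have : (d : ℝ) ≤ n := by exact_mod_cast hdn
            gcongr
          gcongr
      _ = _ := by field_simp; ring
  have h2 : ‖((ε ^ d * c - D) / D) • H‖ ≤ 2 * K₁ / c * ‖H‖ * (η + ε) := by
    rw [norm_smul, Real.norm_eq_abs, abs_div, abs_of_pos hDpos, abs_sub_comm]
    calc _ ≤ K₁ * ε ^ (d + 1) / (ε ^ d * (c / 2)) * ‖H‖ := by gcongr
      _ = 2 * K₁ / c * ‖H‖ * ε := by field_simp; ring
      _ ≤ _ := by gcongr; linarith
  rw [add_mul]
  exact (norm_add_le _ _).trans (add_le_add h1 h2)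

/-- The quantitative form of the consistency statement: the error is controlled by `ε` and by the
accuracy `η` of the affine approximation of `Df` at scale `2ε`. -/
theorem IsNormalChart.exists_estimate (h : IsNormalChart M x₀ ν f b R C)
    (hM : IsHypersurface d 1 M) (hd : 1 ≤ d) (hν : fderiv ℝ f x₀ = innerSL ℝ ν)
    (hb : HasFDerivAt (fderiv ℝ f) b x₀)
    (hT : ∀ x ∈ M, ‖x - x₀‖ < R → tangentSpace M x = (fderiv ℝ f x).ker)
    (hker : IsKernelPair (d + 1) ρ ξ) (hP : P ∈ projectionChoices d (tangentSpace M x₀)ᗮ) :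
    ∃ K ≥ 0, ∃ ε₀ > 0, ∀ ε, 0 < ε → ε < ε₀ → ∀ η ≥ 0, FDerivApprox x₀ ν f b η (2 * ε) →
      Integrable (variationIntegrand ρ P ε x₀) (smoothVarifold M hM) ∧
      Integrable (massIntegrand ξ ε x₀) (mass (smoothVarifold M hM)) ∧
      0 < ∫ x, massIntegrand ξ ε x₀ x ∂(mass (smoothVarifold M hM)) ∧
      ‖regMeanCurvature ρ ξ P ε x₀ (smoothVarifold M hM) - meanCurvatureVector M x₀‖ ≤
        K * (η + ε) := by
  obtain ⟨A, hA⟩ := hker.exists_kernelBounds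
  have hA0 := hA.nonneg
  have hC := h.const_nonneg
  have hξ := hker.smooth_xi.continuous
  have hT₀ := tangentSpace_base_eq hν (hT x₀ h.base_mem (by simpa using h.radius_pos))
  rw [hT₀] at hP
  have hH : meanCurvatureVector M x₀ = _ := (h.meanCurvatureVector_eq hb hν hT).trans
    (sum_stdOrthonormalBasis_congr hT₀ fun v => -b v v • ν)
  have : Nontrivial (ℝ ∙ ν)ᗮ :=
    Module.nontrivial_of_finrank_pos (R := ℝ) (by rw [h.finrank_orthogonal]; exact hd)
  have hc : 0 < ∫ y : (ℝ ∙ ν)ᗮ, ξ ‖y‖ := hker.integral_xi_pos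
  set c := ∫ y : (ℝ ∙ ν)ᗮ, ξ ‖y‖ with hcdef
  set W := (volume : Measure (ℝ ∙ ν)ᗮ).real (Metric.ball 0 1) with hW
  have hW_nonneg : 0 ≤ W := measureReal_nonneg
  set K₁ := (16 * A * C ^ 2 * (1 + 3 ^ d) + A * (3 ^ d * (4 * C ^ 2))) * W with hK₁
  set K₂ := A * ((40 + 80 * C ^ 2 + 32 * C ^ 2 * (2 + C)) * (1 + 3 ^ d) +
          (2 + C) * (3 ^ d * (4 * C ^ 2))) * W with hK₂
  have hK₁0 : 0 ≤ K₁ := by positivity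
  have hK₂0 : 0 ≤ K₂ := by positivity
  refine ⟨2 * K₂ / c + 2 * K₁ / c * ‖meanCurvatureVector M x₀‖, by positivity,
    min (R / 2) (min 1 (c / (2 * (K₁ + 1)))),
    lt_min (half_pos h.radius_pos) (lt_min one_pos (by positivity)), ?_⟩
  intro ε hε hεlt η hη ha
  have hεR : 2 * ε < R := by linarith [hεlt.trans_le (min_le_left _ _)]
  have hε1 : ε ≤ 1 := (hεlt.trans_le ((min_le_right _ _).trans (min_le_left _ _))).le
  have hεc : K₁ * ε ≤ c / 2 := by
    have h1 := (hεlt.trans_le ((min_le_right _ _).trans (min_le_right _ _))).le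
    rw [le_div_iff₀ (by positivity)] at h1
    nlinarith
  have hΦ : Measurable fun x : M => (x.1, tangentPlane hM x) :=
    (continuous_subtype_val.prodMk (continuous_tangentPlane hM)).measurable
  have hmass : mass (smoothVarifold M hM) =
      (Measure.comap Subtype.val μHE[d] : Measure M).map Subtype.val := by
    rw [mass, smoothVarifold, Measure.map_map measurable_fst hΦ]
    rfl
  have hvm : AEStronglyMeasurable (variationIntegrand ρ P ε x₀) (smoothVarifold M hM) :=
    (measurable_variationIntegrand (continuous_projectionChoice hP)).aestronglyMeasurable
  have hmm : AEStronglyMeasurable (massIntegrand ξ ε x₀) (mass (smoothVarifold M hM)) := by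
    unfold massIntegrand
    exact Continuous.aestronglyMeasurable (by fun_prop)
  obtain ⟨hvi, hve⟩ := h.variation_estimate hM hd hT hε hεR hε1 hξ hA hP hη ha
  obtain ⟨hmi, hme⟩ := h.mass_estimate hM.measurableSet hε hεR hξ hA
  have hvint : ∫ p, variationIntegrand ρ P ε x₀ p ∂(smoothVarifold M hM) =
      ∫ x : M, variationIntegrand ρ P ε x₀ (x, tangentPlane hM x)
        ∂(Measure.comap Subtype.val μHE[d]) := integral_map hΦ.aemeasurable hvm
  have hmint : ∫ x, massIntegrand ξ ε x₀ x ∂(mass (smoothVarifold M hM)) =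
      ∫ x : M, massIntegrand ξ ε x₀ x ∂(Measure.comap Subtype.val μHE[d]) := by
    rw [hmass] at hmm ⊢
    exact integral_map measurable_subtype_coe.aemeasurable hmm
  rw [← hvint, ← hH] at hve
  rw [← hmint] at hme
  have hme' : |∫ x, massIntegrand ξ ε x₀ x ∂(mass (smoothVarifold M hM)) - ε ^ d * c| ≤
      K₁ * ε ^ (d + 1) := by
    refine hme.trans ?_
    have : (16 * A * C ^ 2 * ε ^ 2 * (1 + 3 ^ d) + A * (3 ^ d * (4 * C ^ 2 * ε ^ 2))) *
        (ε ^ d * W) = K₁ * ε ^ (d + 1) * ε := by rw [hK₁]; ring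
    rw [this]
    exact mul_le_of_le_one_right (by positivity) hε1
  have hfin := norm_quotient_sub_le hd (Nat.le_succ d) hε hc hη hve hme' hεc
  refine ⟨(integrable_map_measure hvm hΦ.aemeasurable).2 hvi, ?_, hfin.1, hfin.2⟩
  rw [hmass] at hmm ⊢
  exact (integrable_map_measure hmm measurable_subtype_coe.aemeasurable).2 hmi

end Assembly

theorem proposition3p1 {d : ℕ} (hd : 1 ≤ d) (ρ ξ : ℝ → ℝ) (hker : IsKernelPair (d + 1) ρ ξ)
    (M : Set (EuclideanSpace ℝ (Fin (d + 1)))) (hM : IsHypersurface d 2 M)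
    (V : Measure (EuclideanSpace ℝ (Fin (d + 1)) × Grassmannian d (d + 1)))
    (hV : V = smoothVarifold M (hM.of_le one_le_two))
    (x₀ : EuclideanSpace ℝ (Fin (d + 1))) (hx₀ : x₀ ∈ M)
    (P : EuclideanSpace ℝ (Fin (d + 1)) × Grassmannian d (d + 1) →
      (EuclideanSpace ℝ (Fin (d + 1)) →L[ℝ] EuclideanSpace ℝ (Fin (d + 1))))
    (hP : P ∈ projectionChoices d (tangentSpace M x₀)ᗮ) :
    (∀ᶠ ε : ℝ in 𝓝[>] 0,
      Integrable (variationIntegrand ρ P ε x₀) V ∧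
      Integrable (massIntegrand ξ ε x₀) (mass V) ∧
      0 < ∫ x, massIntegrand ξ ε x₀ x ∂(mass V)) ∧
    Tendsto (fun ε : ℝ => regMeanCurvature ρ ξ P ε x₀ V) (𝓝[>] 0)
      (𝓝 (meanCurvatureVector M x₀)) ∧
    (IsHypersurface d 3 M →
      (fun ε : ℝ => regMeanCurvature ρ ξ P ε x₀ V - meanCurvatureVector M x₀)
        =O[𝓝[>] 0] (fun ε : ℝ => ε)) := by
  subst hV
  have hsmall : ∀ a > 0, ∀ᶠ ε : ℝ in 𝓝[>] 0, 0 < ε ∧ ε < a := fun a ha =>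
    Ioo_mem_nhdsGT ha
  have hderiv : ∀ {f : EuclideanSpace ℝ (Fin (d + 1)) → ℝ} {k : ℕ}, 2 ≤ k → ContDiffAt ℝ k f x₀ →
      HasFDerivAt (fderiv ℝ f) (fderiv ℝ (fderiv ℝ f) x₀) x₀ := fun {f k} hk hf =>
    (((hf.of_le (by exact_mod_cast hk : (2 : WithTop ℕ∞) ≤ k)).fderiv_right (m := 1)
      (by norm_num)).differentiableAt (by simp)).hasFDerivAt
  obtain ⟨ν, f, R, C, h, hf, hν, hT⟩ := hM.exists_isNormalChart le_rfl hx₀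
  obtain ⟨K, hK0, ε₀, hε₀, hest⟩ := h.exists_estimate (hM.of_le one_le_two) hd hν
    (hderiv le_rfl hf) hT hker hP
  refine ⟨?_, ?_, fun hM3 => ?_⟩
  · obtain ⟨r₀, hr₀, happ⟩ := exists_fderivApprox hν hf one_pos
    filter_upwards [hsmall ε₀ hε₀, hsmall (r₀ / 2) (half_pos hr₀)] with ε h1 h2
    have := hest ε h1.1 h1.2 1 zero_le_one (happ _ (by linarith [h2.2]))
    exact ⟨this.1, this.2.1, this.2.2.1⟩
  · rw [Metric.tendsto_nhds]
    intro τ hτ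
    have hη : 0 < τ / (2 * (K + 1)) := by positivity
    obtain ⟨r₀, hr₀, happ⟩ := exists_fderivApprox hν hf hη
    filter_upwards [hsmall ε₀ hε₀, hsmall (r₀ / 2) (half_pos hr₀), hsmall _ hη] with ε h1 h2 h3
    have := (hest ε h1.1 h1.2 _ hη.le (happ _ (by linarith [h2.2]))).2.2.2
    rw [dist_eq_norm]
    calc _ ≤ K * (τ / (2 * (K + 1)) + ε) := this
      _ ≤ K * (τ / (2 * (K + 1)) + τ / (2 * (K + 1))) := by gcongr; exact h3.2.le
      _ = K / (K + 1) * τ := by field_simp; ring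
      _ < τ := mul_lt_of_lt_one_left hτ ((div_lt_one (by positivity)).2 (by linarith))
  · -- a `C³` equation of `M` need not be the one chosen above
    obtain ⟨ν, f, R, C, h, hf, hν, hT⟩ := hM3.exists_isNormalChart (by norm_num) hx₀
    obtain ⟨K, hK0, ε₀, hε₀, hest⟩ := h.exists_estimate (hM.of_le one_le_two) hd hν
      (hderiv (by norm_num) hf) hT hker hP
    obtain ⟨L, hL, r₀, hr₀, happ⟩ := exists_fderivApprox_mul hν hf
    refine Asymptotics.IsBigO.of_bound (K * (2 * L + 1)) ?_
    filter_upwards [hsmall ε₀ hε₀, hsmall (r₀ / 2) (half_pos hr₀)] with ε h1 h2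
    have hε := h1.1
    have := (hest ε h1.1 h1.2 (L * (2 * ε)) (by positivity) (happ _ (by linarith [h2.2]))).2.2.2
    rw [Real.norm_of_nonneg hε.le]
    calc _ ≤ K * (L * (2 * ε) + ε) := this
      _ = _ := by ring
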